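/- Let $\Gamma$ be a group generated by a finite set $S$, with word distance $d$ coming from $S$. Assume that $\Gamma$ is Gromov-hyperbolic (for some $\delta$, each side of any geodesic triangle in the Cayley graph of $S$ lies in the $\delta$-neighborhood of the union of the other two) and non-elementary ($\Gamma$ is quasi-isometric neither to a point nor to $\mathbb Z$). Let $\mu$ be an admissible probability measure on $\Gamma$, i.e. the support of $\mu$ generates $\Gamma$ as a semigroup. Let $p_n(x,y)$ be the $n$-step transition probabilities of the random walk with one-step transitions $p(x,y)=\mu(x^{-1}y)$, let $$R=\Bigl(\limsup_{n\to\infty} p_n(e,e)^{1/n}\Bigr)^{-1}$$ be the inverse of its spectral radius, and set $$G_r(x,y)=\sum_{n\ge 0} r^n p_n(x,y)\in[0,\infty],\qquad H_r(x,y)=G_r(x,y)\,G_r(y,x),\qquad \eta(r)=\sum_{x\in\Gamma}H_r(e,x)\in[0,\infty].$$ Assume that $\mu$ satisfies uniform Ancona inequalities: for every $D\ge 0$ there is $C>0$ such that $$G_r(x,z)\le C\,G_r(x,y)\,G_r(y,z)$$ for all $r\in[1,R]$, all $x,z\in\Gamma$ and all $y\in\Gamma$ within distance $D$ of a geodesic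 segment from $x$ to $z$. Then: 1. There exists $C>0$ such that, for all $r\in[1,R)$, $\eta(r)<\infty$ and $$C^{-1}\le\frac{\sum_{x,y\in\Gamma}G_r(e,y)\,G_r(y,x)\,G_r(x,e)}{\bigl(\sum_{x\in\Gamma}G_r(e,x)\,G_r(x,e)\bigr)^3}\le C.$$ 2. There exist $A\ge 0$ and $C>0$ such that, for all $r\in[1,R)$, $$\frac{C^{-1}}{\sqrt{A+(R-r)}}\le\eta(r)\le\frac{C}{\sqrt{A+(R-r)}},$$ and moreover $A=0$ if and only if $\eta(R)=+\infty$. -/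

import Mathlib

open scoped ENNReal

noncomputable section

namespace RandomWalk

/-! ### Coarse geometry of a finitely generated group

The Cayley graph of `Γ` with respect to `S` is Mathlib's `SimpleGraph.mulCayley S`, in which
`u` and `v` are joined when `u ≠ v` and `u⁻¹ * v ∈ S ∪ S⁻¹`; the word distance is its graph
distance. -/

/-- The word distance on `Γ` coming from `S` (invariant under left translations). -/
def wordDist {Γ : Type*} [Group Γ] (S : Set Γ) (x y : Γ) : ℕ :=
  (SimpleGraph.mulCayley S).dist x y

/-- A walk in a graph is a geodesic segment if its length is the distance of its endpoints. -/
def IsGeodesic {V : Type*} {G : SimpleGraph V} {x y : V} (p : G.Walk x y) : Prop :=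
  p.length = G.dist x y

/-- Gromov hyperbolicity of the Cayley graph of `Γ` with respect to `S`: there is `δ` such that
each side of every geodesic triangle is in the `δ`-neighborhood of the union of the two others. -/
def IsHyperbolic {Γ : Type*} [Group Γ] (S : Set Γ) : Prop :=
  ∃ δ : ℕ, ∀ (x y z : Γ) (p : (SimpleGraph.mulCayley S).Walk x y)
    (q : (SimpleGraph.mulCayley S).Walk y z) (s : (SimpleGraph.mulCayley S).Walk z x),
    IsGeodesic p → IsGeodesic q → IsGeodesic s →
      ∀ u ∈ p.support, ∃ v, (v ∈ q.support ∨ v ∈ s.support) ∧ wordDist S u v ≤ δ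

/-- Two sets with distances `dX` and `dY` are quasi-isometric. -/
def QuasiIsometric {X Y : Type*} (dX : X → X → ℝ) (dY : Y → Y → ℝ) : Prop :=
  ∃ (f : X → Y) (K C : ℝ), 1 ≤ K ∧ 0 ≤ C ∧
    (∀ x x', K⁻¹ * dX x x' - C ≤ dY (f x) (f x') ∧ dY (f x) (f x') ≤ K * dX x x' + C) ∧
    (∀ y, ∃ x, dY y (f x) ≤ C)

/-- `Γ`, with the word distance coming from `S`, is non-elementary: it is quasi-isometric neither
to a point nor to `ℤ`. -/
def IsNonElementary {Γ : Type*} [Group Γ] (S : Set Γ) : Prop :=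
  ¬ QuasiIsometric (fun x y : Γ => (wordDist S x y : ℝ)) (fun a b : Unit => dist a b) ∧
  ¬ QuasiIsometric (fun x y : Γ => (wordDist S x y : ℝ)) (fun a b : ℤ => dist a b)

/-! ### The random walk and its Green function -/

/-- `μ` is admissible: its support generates `Γ` as a semigroup. -/
def IsAdmissible {Γ : Type*} [Group Γ] (μ : PMF Γ) : Prop :=
  Subsemigroup.closure μ.support = ⊤

/-- The `n`-step transition probability `p_n(x, y)` of the random walk with one-step transition
probability `p(x, y) = μ(x⁻¹ y)`. -/
def transition {Γ : Type*} [Group Γ] (μ : PMF Γ) : ℕ → Γ → Γ → ℝ≥0∞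
  | 0, x, y => Set.indicator {x} 1 y
  | n + 1, x, y => ∑' z, transition μ n x z * μ (z⁻¹ * y)

/-- `R(μ)`, the inverse of the spectral radius `limsup p_n(e, e) ^ (1 / n)`. -/
def invSpectralRadius {Γ : Type*} [Group Γ] (μ : PMF Γ) : ℝ :=
  ((Filter.limsup (fun n : ℕ => transition μ n 1 1 ^ (1 / (n : ℝ))) Filter.atTop)⁻¹).toReal

/-- The Green function `G_r(x, y) = ∑ rⁿ p_n(x, y)`, with values in `[0, ∞]`. -/
def green {Γ : Type*} [Group Γ] (μ : PMF Γ) (r : ℝ) (x y : Γ) : ℝ≥0∞ :=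
  ∑' n : ℕ, ENNReal.ofReal r ^ n * transition μ n x y

/-- `H_r(x, y) = G_r(x, y) G_r(y, x)`. -/
def greenH {Γ : Type*} [Group Γ] (μ : PMF Γ) (r : ℝ) (x y : Γ) : ℝ≥0∞ :=
  green μ r x y * green μ r y x

/-- `η(r) = ∑_x H_r(e, x)`, with values in `[0, ∞]`. -/
def eta {Γ : Type*} [Group Γ] (μ : PMF Γ) (r : ℝ) : ℝ≥0∞ :=
  ∑' x, greenH μ r 1 x

/-- Uniform Ancona inequalities, with respect to the word distance coming from `S`: for every
meaning `D` of "close", there is `C` with `G_r(x, z) ≤ C G_r(x, y) G_r(y, z)` whenever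
`r ∈ [1, R(μ)]` and `y` is within distance `D` of a geodesic segment from `x` to `z`. -/
def UniformAncona {Γ : Type*} [Group Γ] (S : Set Γ) (μ : PMF Γ) : Prop :=
  ∀ D : ℕ, ∃ C : ℝ, 0 < C ∧
    ∀ (x z : Γ) (p : (SimpleGraph.mulCayley S).Walk x z), IsGeodesic p →
      ∀ y : Γ, (∃ w ∈ p.support, wordDist S y w ≤ D) →
        ∀ r ∈ Set.Icc 1 (invSpectralRadius μ),
          green μ r x z ≤ ENNReal.ofReal C * (green μ r x y * green μ r y z)

end RandomWalk

end

/-!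
Write `aₙ = pₙ(e, e)`, `g = G_R(e, e)`, and `T(r) = ∑_{x, y} G_r(e, y) G_r(y, x) G_r(x, e)`. By the
Chapman-Kolmogorov equation `η(r) = ∑ (n + 1) aₙ rⁿ` and `2 T(r) = ∑ (n + 1) (n + 2) aₙ rⁿ`, so that
`(r² η)' = 2 r T` (`hasDerivAt_sq_mul_eta`). Once `T ≍ η³` is known, `(r² η)⁻²` has a derivative
between two negative constants, and integration up to `R` gives the second part, with `A` the value
of `(r² η)⁻²` at `R` (`exists_inv_sqrt_bounds`).

The bound `T ≤ C η³` (`exists_tsum_greenTriangle_le`) comes from the Ancona inequalities at the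
center `w` of the triangle with vertices `e`, `x`, `y`: they replace the product along the sides by
`H_r(e, w) H_r(w, x) H_r(w, y)`.

The bound `η³ ≤ C T` (`exists_eta_cube_le`) holds because three branches `e → w`, `w → x`, `w → y`
can be put in general position by inserting elements of a fixed ball after `w`
(`IsHyperbolicMetric.exists_turn`); then `w` is determined by `x` and `y` up to finitely many
choices, and `G_r(x, w) G_r(w, y) ≤ g G_r(x, y)`. This needs two facts.

* Turning is possible because otherwise all elements of a large ball would move a fixed segment
  along one of two geodesics, and there are at most linearly many of these. On the other hand the
  growth is superlinear (`IsHyperbolicMetric.superlinear_growth`): `Γ` contains a geodesic line, and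
  since `Γ` is not quasi-isometric to `ℤ` there are points arbitrarily far from it, hence tripods
  of all sizes, which can be planted along a long geodesic.
* `g` is finite (`green_spectral_ne_top`). The first-visit functions `F_r` are supermultiplicative,
  so that the sums of `F_r(e, x) F_r(x, e)` over spheres are bounded uniformly in `r < R`
  (`exists_sum_sphere_le`). If `g` were infinite, the uniqueness of superharmonic functions would
  give `F_R(e, x) F_R(x, e) = 1` for all `x`, and the spheres would have bounded cardinality.
-/

namespace RandomWalk

/-! ### The word metric and the four-point condition -/

/-- `d` is a left-invariant geodesic metric with finite balls on a group, with integer values,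
which is Gromov-hyperbolic in the form of the four-point condition: of the three sums of opposite
distances of four points, the largest exceeds the second largest by at most `k`. -/
structure IsHyperbolicMetric {Γ : Type*} [Group Γ] (d : Γ → Γ → ℕ) (k : ℕ) : Prop where
  self : ∀ x, d x x = 0
  eq_of_dist_eq_zero : ∀ x y, d x y = 0 → x = y
  comm : ∀ x y, d x y = d y x
  triangle : ∀ x y z, d x z ≤ d x y + d y z
  left_inv : ∀ g x y, d (g * x) (g * y) = d x y
  geodesic : ∀ x y i, i ≤ d x y → ∃ z, d x z = i ∧ d x z + d z y = d x y
  finite_ball : ∀ n, {x | d 1 x ≤ n}.Finite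
  four_point : ∀ x y z w, d x y + d z w ≤ d x z + d y w + k ∨ d x y + d z w ≤ d x w + d y z + k

section WordDist

variable {Γ : Type*} [Group Γ] {S : Set Γ}

lemma mulCayley_connected (hS : Subgroup.closure S = ⊤) :
    (SimpleGraph.mulCayley S).Connected := by
  have key : ∀ g : Γ, ∀ x, (SimpleGraph.mulCayley S).Reachable x (x * g) := by
    intro g
    have hg : g ∈ Subgroup.closure S := hS ▸ Subgroup.mem_top g
    induction hg using Subgroup.closure_induction with
    | mem g hg =>
      intro x
      by_cases h : x = x * g
      · rw [← h]
      · exact SimpleGraph.Adj.reachable ((SimpleGraph.mulCayley_adj S _ _).2 ⟨h, by simp [hg]⟩)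
    | one => intro x; rw [mul_one]
    | mul g h _ _ ihg ihh => intro x; rw [← mul_assoc]; exact (ihg x).trans (ihh _)
    | inv g _ ih => intro x; simpa using (ih (x * g⁻¹)).symm
  exact ⟨fun x y => by simpa using key (x⁻¹ * y) x⟩

lemma wordDist_mul_left (g x y : Γ) : wordDist S (g * x) (g * y) = wordDist S x y := by
  have key : ∀ (g x y : Γ), (∃ p : (SimpleGraph.mulCayley S).Walk x y, True) →
      wordDist S (g * x) (g * y) ≤ wordDist S x y := by
    intro g x y ⟨p, _⟩
    obtain ⟨q, hq⟩ := p.reachable.exists_walk_length_eq_dist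
    let φ : SimpleGraph.mulCayley S →g SimpleGraph.mulCayley S :=
      ⟨fun z => g * z, fun h => SimpleGraph.mulCayley_adj_mul_iff_right.2 h⟩
    have := SimpleGraph.dist_le (q.map φ)
    rw [SimpleGraph.Walk.length_map, hq] at this
    exact this
  by_cases h : (SimpleGraph.mulCayley S).Reachable x y
  · obtain ⟨p⟩ := h
    refine le_antisymm (key g x y ⟨p, trivial⟩) ?_
    let φ : SimpleGraph.mulCayley S →g SimpleGraph.mulCayley S :=
      ⟨fun z => g * z, fun h => SimpleGraph.mulCayley_adj_mul_iff_right.2 h⟩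
    simpa using key g⁻¹ (g * x) (g * y) ⟨p.map φ, trivial⟩
  · have h' : ¬ (SimpleGraph.mulCayley S).Reachable (g * x) (g * y) := by
      rintro ⟨p⟩
      let φ : SimpleGraph.mulCayley S →g SimpleGraph.mulCayley S :=
        ⟨fun z => g⁻¹ * z, fun h => SimpleGraph.mulCayley_adj_mul_iff_right.2 h⟩
      exact h ⟨(p.map φ).copy (by simp [φ]) (by simp [φ])⟩
    rw [wordDist, wordDist, SimpleGraph.dist_eq_zero_of_not_reachable h,
      SimpleGraph.dist_eq_zero_of_not_reachable h']

/-- The vertices of a geodesic are the points at which the triangle inequality is an equality. -/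
lemma IsGeodesic.between {V : Type*} {G : SimpleGraph V} (hG : G.Connected) {x y : V}
    {p : G.Walk x y} (hp : IsGeodesic p) {u : V} (hu : u ∈ p.support) :
    G.dist x u + G.dist u y = G.dist x y := by
  classical
  have h1 := SimpleGraph.dist_le (p.takeUntil u hu)
  have h2 := SimpleGraph.dist_le (p.dropUntil u hu)
  have h3 := congrArg SimpleGraph.Walk.length (p.take_spec hu)
  rw [SimpleGraph.Walk.length_append] at h3
  have h4 := hG.dist_triangle (u := x) (v := u) (w := y)
  unfold IsGeodesic at hp
  omega

lemma exists_isGeodesic_mem_support {V : Type*} {G : SimpleGraph V} (hG : G.Connected) {x y u : V}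
    (h : G.dist x u + G.dist u y = G.dist x y) :
    ∃ p : G.Walk x y, IsGeodesic p ∧ u ∈ p.support := by
  obtain ⟨p, hp⟩ := hG.exists_walk_length_eq_dist x u
  obtain ⟨q, hq⟩ := hG.exists_walk_length_eq_dist u y
  refine ⟨p.append q, ?_, ?_⟩
  · rw [IsGeodesic, SimpleGraph.Walk.length_append]; omega
  · simp

lemma wordDist_geodesic (hG : (SimpleGraph.mulCayley S).Connected) (x y : Γ) (i : ℕ)
    (hi : i ≤ wordDist S x y) :
    ∃ z, wordDist S x z = i ∧ wordDist S x z + wordDist S z y = wordDist S x y := by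
  obtain ⟨p, hp⟩ := hG.exists_walk_length_eq_dist x y
  have h1 := SimpleGraph.dist_le (p.take i)
  have h2 := SimpleGraph.dist_le (p.drop i)
  have h4 := hG.dist_triangle (u := x) (v := p.getVert i) (w := y)
  rw [SimpleGraph.Walk.take_length] at h1
  rw [SimpleGraph.Walk.drop_length] at h2
  unfold wordDist at *
  refine ⟨p.getVert i, ?_, ?_⟩ <;> omega

lemma wordDist_finite_ball (hS : S.Finite) (hG : (SimpleGraph.mulCayley S).Connected) (n : ℕ) :
    {x | wordDist S 1 x ≤ n}.Finite := by
  induction n with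
  | zero =>
    refine (Set.finite_singleton (1 : Γ)).subset fun x hx => ?_
    exact (hG.dist_eq_zero_iff.1 (Nat.le_zero.1 hx)).symm
  | succ n ih =>
    have hT : (S ∪ S⁻¹).Finite := hS.union hS.inv
    refine (ih.union (Set.Finite.image2 (· * ·) ih hT)).subset fun x hx => ?_
    by_cases h : wordDist S 1 x ≤ n
    · exact Or.inl h
    · right
      have hx' : wordDist S 1 x = n + 1 := le_antisymm hx (by omega)
      obtain ⟨z, hz, hz'⟩ := wordDist_geodesic hG 1 x n (by omega)
      have h1 : wordDist S z x = 1 := by omega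
      have := (SimpleGraph.mulCayley_adj S _ _).1 (SimpleGraph.dist_eq_one_iff_adj.1 h1)
      refine ⟨z, hz.le, z⁻¹ * x, ?_, by simp⟩
      rcases this.2 with h | h
      · exact Or.inl h
      · right; simpa using h

/-- Thin triangles, in terms of points between two others instead of geodesics. -/
lemma thin_between (hG : (SimpleGraph.mulCayley S).Connected) (hhyp : IsHyperbolic S) :
    ∃ δ : ℕ, ∀ x y z u, wordDist S x u + wordDist S u y = wordDist S x y →
      ∃ v, (wordDist S y v + wordDist S v z = wordDist S y z ∨
        wordDist S x v + wordDist S v z = wordDist S x z) ∧ wordDist S u v ≤ δ := by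
  obtain ⟨δ, hδ⟩ := hhyp
  refine ⟨δ, fun x y z u hu => ?_⟩
  obtain ⟨p, hp, hup⟩ := exists_isGeodesic_mem_support hG hu
  obtain ⟨q, hq⟩ := hG.exists_walk_length_eq_dist y z
  obtain ⟨s, hs⟩ := hG.exists_walk_length_eq_dist z x
  obtain ⟨v, hv, huv⟩ := hδ x y z p q s hp hq hs u hup
  refine ⟨v, ?_, huv⟩
  rcases hv with hv | hv
  · exact Or.inl (IsGeodesic.between hG hq hv)
  · right
    have h1 := IsGeodesic.between hG hs hv
    unfold wordDist
    rw [SimpleGraph.dist_comm (u := x) (v := v), SimpleGraph.dist_comm (u := v) (v := z),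
      SimpleGraph.dist_comm (u := x) (v := z)]
    omega

/-- Every geodesic triangle has a center, a point of one side which is close to the two others. -/
lemma exists_center (hG : (SimpleGraph.mulCayley S).Connected) (hhyp : IsHyperbolic S) :
    ∃ D : ℕ, ∀ x y z, ∃ w, wordDist S x w + wordDist S w y = wordDist S x y ∧
      (∃ v, wordDist S y v + wordDist S v z = wordDist S y z ∧ wordDist S w v ≤ D) ∧
      (∃ v, wordDist S x v + wordDist S v z = wordDist S x z ∧ wordDist S w v ≤ D) := by
  classical
  obtain ⟨δ, hδ⟩ := thin_between hG hhyp
  refine ⟨δ + 1, fun x y z => ?_⟩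
  have self : ∀ a : Γ, wordDist S a a = 0 := fun a => SimpleGraph.dist_self
  have tri : ∀ a b c : Γ, wordDist S a c ≤ wordDist S a b + wordDist S b c :=
    fun a b c => hG.dist_triangle
  have comm : ∀ a b : Γ, wordDist S a b = wordDist S b a := fun a b => SimpleGraph.dist_comm
  -- The center is the first point of `[x, y]` which is close to `[y, z]`.
  let P : ℕ → Prop := fun i => ∃ w, wordDist S x w = i ∧
    wordDist S x w + wordDist S w y = wordDist S x y ∧
    ∃ v, wordDist S y v + wordDist S v z = wordDist S y z ∧ wordDist S w v ≤ δ
  have hP : ∃ i, P i := ⟨wordDist S x y, y, rfl, by simp [self], y, by simp [self], by simp [self]⟩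
  obtain ⟨w, hw, hwb, v, hv, hwv⟩ := Nat.find_spec hP
  refine ⟨w, hwb, ⟨v, hv, by omega⟩, ?_⟩
  by_cases h0 : Nat.find hP = 0
  · have hxw : x = w := hG.dist_eq_zero_iff.1 (hw.trans h0)
    exact ⟨x, by simp [self], by simp [← hxw, self]⟩
  · obtain ⟨w', hw', hwb'⟩ := wordDist_geodesic hG x w (Nat.find hP - 1) (by omega)
    have hb : wordDist S x w' + wordDist S w' y = wordDist S x y := by
      have := tri w' w y
      have := tri x w' y
      omega
    have hnot : ¬ P (wordDist S x w') := Nat.find_min hP (by omega)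
    obtain ⟨v', hv', hwv'⟩ := hδ x y z w' hb
    rcases hv' with hv' | hv'
    · exact absurd ⟨w', rfl, hb, v', hv', hwv'⟩ hnot
    · refine ⟨v', hv', ?_⟩
      have := tri w w' v'
      have := comm w w'
      omega

/-- Thin triangles give the four-point condition: the distance to the center of a triangle is,
up to a constant, the Gromov product. -/
lemma isHyperbolicMetric_wordDist (hSfin : S.Finite) (hS : Subgroup.closure S = ⊤)
    (hhyp : IsHyperbolic S) : ∃ k, IsHyperbolicMetric (wordDist S) k := by
  have hG := mulCayley_connected hS
  have tri : ∀ a b c : Γ, wordDist S a c ≤ wordDist S a b + wordDist S b c :=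
    fun a b c => hG.dist_triangle
  have comm : ∀ a b : Γ, wordDist S a b = wordDist S b a := fun a b => SimpleGraph.dist_comm
  obtain ⟨δ, hδ⟩ := thin_between hG hhyp
  obtain ⟨D, hD⟩ := exists_center hG hhyp
  refine ⟨4 * D + 2 * δ, ⟨fun a => SimpleGraph.dist_self, fun x y h => hG.dist_eq_zero_iff.1 h,
    comm, tri, wordDist_mul_left, wordDist_geodesic hG, wordDist_finite_ball hSfin hG, ?_⟩⟩
  intro x z y w
  obtain ⟨p, hp, ⟨q, hq, hpq⟩, ⟨s, hs, hps⟩⟩ := hD x z w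
  obtain ⟨v, hv, hpv⟩ := hδ x z y p hp
  have h1 := tri p q w
  have h2 := tri p q z
  have h3 := tri p s w
  have h4 := tri p s x
  have h5 := tri w p v
  have h6 := tri x v w
  have h7 := tri y v w
  have h8 := tri z v w
  have := comm z q
  have := comm s x
  have := comm w p
  have := comm p x
  have := comm w v
  have := comm y v
  have := comm y z
  rcases hv with hv | hv <;> omega

end WordDist

/-! ### Growth and turning in a non-elementary hyperbolic group -/

section Growth

variable {Γ : Type*} [Group Γ] {d : Γ → Γ → ℕ} {k : ℕ}

/-- The ball of radius `n` around the identity. -/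
noncomputable def IsHyperbolicMetric.ball (hd : IsHyperbolicMetric d k) (n : ℕ) : Finset Γ :=
  (hd.finite_ball n).toFinset

lemma IsHyperbolicMetric.mem_ball (hd : IsHyperbolicMetric d k) {n : ℕ} {x : Γ} :
    x ∈ hd.ball n ↔ d 1 x ≤ n := by
  simp [IsHyperbolicMetric.ball]

lemma IsHyperbolicMetric.dist_one_inv_mul (hd : IsHyperbolicMetric d k) (x y : Γ) :
    d 1 (x⁻¹ * y) = d x y := by
  rw [← hd.left_inv x 1, mul_one, mul_inv_cancel_left]

lemma IsHyperbolicMetric.dist_mul_right (hd : IsHyperbolicMetric d k) (w x y : Γ) :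
    d y (w * x) = d (w⁻¹ * y) x := by
  rw [← hd.left_inv w⁻¹ y, inv_mul_cancel_left]

lemma IsHyperbolicMetric.exists_geodesic_path (hd : IsHyperbolicMetric d k) (n : ℕ) :
    ∀ x y, d x y = n → ∃ c : ℕ → Γ, c 0 = x ∧ c n = y ∧
      ∀ i j, i ≤ j → j ≤ n → d (c i) (c j) = j - i := by
  induction n with
  | zero =>
    intro x y h
    have := hd.eq_of_dist_eq_zero x y h
    refine ⟨fun _ => x, rfl, this, fun i j _ _ => ?_⟩
    rw [hd.self]; omega
  | succ n ih =>
    intro x y h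
    obtain ⟨z, hz, hz'⟩ := hd.geodesic x y n (by omega)
    obtain ⟨c, h0, hn, hc⟩ := ih x z hz
    refine ⟨fun i => if i ≤ n then c i else y, by simp [h0], by simp, fun i j hij hj => ?_⟩
    by_cases hjn : j ≤ n
    · simp [hjn, hij.trans hjn, hc i j hij hjn]
    · by_cases hin : i ≤ n
      · simp only [hin, hjn, if_true, if_false]
        have h1 := hc i n hin le_rfl
        have h2 := hc 0 i (Nat.zero_le _) hin
        rw [hn] at h1
        rw [h0] at h2
        have := hd.triangle (c i) z y
        have := hd.triangle x (c i) y
        omega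
      · simp only [hin, hjn, if_false, hd.self]; omega

/-- In an infinite group, longer and longer geodesic segments centered at the identity have a
subsequential limit, taken here along an ultrafilter. -/
lemma IsHyperbolicMetric.exists_geodesic_line (hd : IsHyperbolicMetric d k)
    (hinf : ∀ n, ∃ x, n ≤ d 1 x) : ∃ γ : ℤ → Γ, ∀ s t, (d (γ s) (γ t) : ℤ) = |s - t| := by
  have step : ∀ n : ℕ, ∃ γ : ℤ → Γ, γ 0 = 1 ∧
      ∀ s t : ℤ, -n ≤ s → s ≤ n → -n ≤ t → t ≤ n → (d (γ s) (γ t) : ℤ) = |s - t| := by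
    intro n
    obtain ⟨x, hx⟩ := hinf (2 * n)
    obtain ⟨y, hy, -⟩ := hd.geodesic 1 x (2 * n) hx
    obtain ⟨c, -, -, hc⟩ := hd.exists_geodesic_path (2 * n) 1 y hy
    refine ⟨fun s => (c n)⁻¹ * c (n + s).toNat, by simp, fun s t hs hs' ht ht' => ?_⟩
    rw [hd.left_inv]
    rcases le_total s t with h | h
    · rw [hc _ _ (by omega) (by omega), abs_of_nonpos (by omega)]; omega
    · rw [hd.comm, hc _ _ (by omega) (by omega), abs_of_nonneg (by omega)]; omega
  choose γ h0 hγ using step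
  let U : Ultrafilter ℕ := Filter.hyperfilter ℕ
  have hU : ∀ m : ℕ, ∀ᶠ n in (U : Filter ℕ), m ≤ n := fun m =>
    Filter.Tendsto.eventually_ge_atTop
      (Filter.tendsto_id.mono_left Nat.hyperfilter_le_atTop) m
  have lim : ∀ t : ℤ, ∃ g, ∀ᶠ n in (U : Filter ℕ), γ n t = g := by
    intro t
    have hfin := hd.finite_ball t.natAbs
    have hev : (⋃ g ∈ {x | d 1 x ≤ t.natAbs}, {n | γ n t = g}) ∈ U := by
      filter_upwards [hU t.natAbs] with n hn
      have := hγ n 0 t (by omega) (by omega) (by omega) (by omega)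
      rw [h0, zero_sub, abs_neg, Int.abs_eq_natAbs] at this
      exact Set.mem_biUnion (x := γ n t) (by exact_mod_cast this.le) rfl
    obtain ⟨g, -, hg⟩ := (Ultrafilter.finite_biUnion_mem_iff hfin).1 hev
    exact ⟨g, hg⟩
  choose g hg using lim
  refine ⟨g, fun s t => ?_⟩
  obtain ⟨n, h1, h2, h3, h4⟩ :=
    ((hg s).and ((hg t).and ((hU s.natAbs).and (hU t.natAbs)))).exists
  rw [← h1, ← h2]
  exact hγ n s t (by omega) (by omega) (by omega) (by omega)

lemma IsHyperbolicMetric.unbounded (hd : IsHyperbolicMetric d k)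
    (hne : ¬ QuasiIsometric (fun x y : Γ => (d x y : ℝ)) (fun a b : Unit => dist a b)) (n : ℕ) :
    ∃ x, n ≤ d 1 x := by
  by_contra! hcon
  refine hne ⟨fun _ => (), 1, 2 * n, le_rfl, by positivity, fun x x' => ?_, fun y => ⟨1, ?_⟩⟩
  · have h : d x x' ≤ 2 * n := by
      have := hd.triangle x 1 x'
      have := hd.comm x 1
      have := hcon x
      have := hcon x'
      omega
    have h' : (d x x' : ℝ) ≤ 2 * n := by exact_mod_cast h
    simp only [dist_self]
    constructor
    · simpa using h'
    · positivity
  · simp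

lemma IsHyperbolicMetric.exists_far_of_line (hd : IsHyperbolicMetric d k)
    (hne : ¬ QuasiIsometric (fun x y : Γ => (d x y : ℝ)) (fun a b : ℤ => dist a b))
    {γ : ℤ → Γ} (hγ : ∀ s t, (d (γ s) (γ t) : ℤ) = |s - t|) (D : ℕ) :
    ∃ x, ∀ t, D ≤ d x (γ t) := by
  by_contra! hcon
  choose f hf using hcon
  refine hne ⟨f, 1, 2 * D, le_rfl, by positivity, fun x x' => ?_, fun y => ⟨γ y, ?_⟩⟩
  · have h1 := hd.triangle (γ (f x)) x (γ (f x'))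
    have h2 := hd.triangle x x' (γ (f x'))
    have h3 := hd.triangle x (γ (f x)) x'
    have h4 := hd.triangle (γ (f x)) (γ (f x')) x'
    have h5 := hd.comm x (γ (f x))
    have h6 := hd.comm x' (γ (f x'))
    have h7 := hf x
    have h8 := hf x'
    have h9 := hγ (f x) (f x')
    have e : dist (f x) (f x') = (d (γ (f x)) (γ (f x')) : ℝ) := by
      rw [Int.dist_eq]
      exact_mod_cast h9.symm
    have i1 : d (γ (f x)) (γ (f x')) ≤ d x x' + 2 * D := by omega
    have i2 : d x x' ≤ d (γ (f x)) (γ (f x')) + 2 * D := by omega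
    have j1 : (d (γ (f x)) (γ (f x')) : ℝ) ≤ d x x' + 2 * D := by exact_mod_cast i1
    have j2 : (d x x' : ℝ) ≤ d (γ (f x)) (γ (f x')) + 2 * D := by exact_mod_cast i2
    simp only [e, inv_one, one_mul]
    constructor <;> linarith
  · have h1 := hf (γ y)
    have h2 := hγ y (f (γ y))
    have e : dist y (f (γ y)) = (d (γ y) (γ (f (γ y))) : ℝ) := by
      rw [Int.dist_eq]
      exact_mod_cast h2.symm
    have j : (d (γ y) (γ (f (γ y))) : ℝ) ≤ D := by exact_mod_cast h1.le
    have : (0 : ℝ) ≤ D := by positivity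
    simp only [e]
    linarith

/-- The four-point condition at the nearest-point projection of a point far from a geodesic line:
the two halves of the line and the segment to the far point form a tripod. -/
lemma IsHyperbolicMetric.exists_tripod (hd : IsHyperbolicMetric d k)
    {γ : ℤ → Γ} (hγ : ∀ s t, (d (γ s) (γ t) : ℤ) = |s - t|)
    (hfar : ∀ D : ℕ, ∃ x, ∀ t, D ≤ d x (γ t)) (n : ℕ) :
    ∃ p v₁ v₂ v₃, d p v₁ = n ∧ d p v₂ = n ∧ d p v₃ = n ∧
      2 * n ≤ d v₁ v₂ + (2 * k + 1) ∧ 2 * n ≤ d v₁ v₃ + (2 * k + 1) ∧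
      2 * n ≤ d v₂ v₃ + (2 * k + 1) := by
  obtain ⟨x, hx⟩ := hfar n
  obtain ⟨_, ⟨t, rfl⟩, ht⟩ :=
    wellFounded_lt.has_min (Set.range fun t => d x (γ t)) (Set.range_nonempty _)
  have hmin : ∀ s, d x (γ t) ≤ d x (γ s) := fun s => not_lt.1 (ht _ ⟨s, rfl⟩)
  obtain ⟨x', hx', hxb⟩ := hd.geodesic (γ t) x n (by rw [hd.comm]; exact hx t)
  -- Apply the four-point condition with the point at distance `k + 1` of the projection.
  have key : ∀ ε : ℤ, |ε| = 1 → 2 * n ≤ d (γ (t + ε * n)) x' + (2 * k + 1) := by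
    intro ε hε
    have abs_eq : ∀ m : ℕ, |ε * (m : ℤ)| = m := fun m => by
      rw [abs_mul, hε, one_mul, Nat.abs_cast]
    have e1 := hγ t (t + ε * n)
    rw [sub_add_cancel_left, abs_neg, abs_eq] at e1
    have := hd.triangle (γ t) (γ (t + ε * n)) x'
    have := hd.triangle (γ (t + ε * n)) x' x
    have := hd.comm (γ t) x
    have := hd.triangle x' (γ t) (γ (t + ε * n))
    by_cases hk : k + 1 ≤ n
    · have e2 := hγ t (t + ε * (k + 1 : ℕ))
      rw [sub_add_cancel_left, abs_neg, abs_eq] at e2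
      have e3 := hγ (t + ε * (k + 1 : ℕ)) (t + ε * n)
      have e4 : t + ε * (k + 1 : ℕ) - (t + ε * n) = -(ε * (n - (k + 1) : ℕ)) := by
        push_cast [hk]; ring
      rw [e4, abs_neg, abs_eq] at e3
      have h1 := hmin (t + ε * (k + 1 : ℕ))
      have h2 := hd.four_point x (γ (t + ε * (k + 1 : ℕ))) (γ t) (γ (t + ε * n))
      have h3 := hd.comm (γ (t + ε * n)) x
      have h4 := hd.comm (γ (t + ε * (k + 1 : ℕ))) (γ t)
      omega
    · omega
  refine ⟨γ t, γ (t + 1 * n), γ (t + (-1) * n), x', ?_, ?_, hx', ?_, key 1 (by simp),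
    key (-1) (by simp)⟩
  · have := hγ t (t + 1 * n); rw [abs_of_nonpos (by omega)] at this; omega
  · have := hγ t (t + (-1) * n); rw [abs_of_nonneg (by omega)] at this; omega
  · have := hγ (t + 1 * n) (t + (-1) * n); rw [abs_of_nonneg (by omega)] at this; omega

/-- Some leg of a tripod avoids two given directions. -/
lemma IsHyperbolicMetric.exists_leg (hd : IsHyperbolicMetric d k)
    (htri : ∀ n, ∃ p v₁ v₂ v₃, d p v₁ = n ∧ d p v₂ = n ∧ d p v₃ = n ∧
      2 * n ≤ d v₁ v₂ + (2 * k + 1) ∧ 2 * n ≤ d v₁ v₃ + (2 * k + 1) ∧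
      2 * n ≤ d v₂ v₃ + (2 * k + 1)) (n : ℕ) (u v : Γ) :
    ∃ z, d 1 z = n ∧ d 1 u + n ≤ d u z + (3 * k + 1) ∧ d 1 v + n ≤ d v z + (3 * k + 1) := by
  obtain ⟨p, v₁, v₂, v₃, h1, h2, h3, h12, h13, h23⟩ := htri n
  have excl : ∀ (u : Γ) {a b : Γ}, d p a = n → d p b = n → 2 * n ≤ d a b + (2 * k + 1) →
      d 1 u + n ≤ d (p * u) a + (3 * k + 1) ∨ d 1 u + n ≤ d (p * u) b + (3 * k + 1) := by
    intro u a b ha hb hab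
    have := hd.four_point a b p (p * u)
    have h := hd.left_inv p 1 u
    rw [mul_one] at h
    have := hd.comm a p
    have := hd.comm b p
    have := hd.comm a (p * u)
    have := hd.comm b (p * u)
    omega
  have fin : ∀ a, d p a = n → d 1 u + n ≤ d (p * u) a + (3 * k + 1) →
      d 1 v + n ≤ d (p * v) a + (3 * k + 1) →
      ∃ z, d 1 z = n ∧ d 1 u + n ≤ d u z + (3 * k + 1) ∧ d 1 v + n ≤ d v z + (3 * k + 1) := by
    intro a ha hu hv
    refine ⟨p⁻¹ * a, by rw [hd.dist_one_inv_mul, ha], ?_, ?_⟩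
    · rw [hd.dist_mul_right, inv_inv]; exact hu
    · rw [hd.dist_mul_right, inv_inv]; exact hv
  rcases excl u h1 h2 h12 with hu | hu <;> rcases excl u h1 h3 h13 with hu' | hu' <;>
    rcases excl u h2 h3 h23 with hu'' | hu'' <;>
    rcases excl v h1 h2 h12 with hv | hv <;> rcases excl v h1 h3 h13 with hv' | hv' <;>
    rcases excl v h2 h3 h23 with hv'' | hv'' <;>
    first
    | exact fin _ h1 (by assumption) (by assumption)
    | exact fin _ h2 (by assumption) (by assumption)
    | exact fin _ h3 (by assumption) (by assumption)

/-- Superlinear growth. Legs of tripods which leave a long geodesic at regularly spaced points are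
disjoint, because the Gromov product of a point of the `j`-th leg with the end of the geodesic is
nearly the position of the branch point. This gives a quadratic number of elements. -/
lemma IsHyperbolicMetric.superlinear_growth (hd : IsHyperbolicMetric d k)
    (hleg : ∀ (n : ℕ) (u v : Γ), ∃ z, d 1 z = n ∧ d 1 u + n ≤ d u z + (3 * k + 1) ∧
      d 1 v + n ≤ d v z + (3 * k + 1)) (c : ℕ) :
    ∃ B, c * (B + 1) < (hd.ball B).card := by
  let L := 3 * k + 2
  let M := 2 * c
  let n := M * L
  obtain ⟨y, hy, -⟩ := hleg n 1 1
  have hw : ∀ j : ℕ, ∃ w, j ≤ M → d 1 w = j * L ∧ d 1 w + d w y = n := by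
    intro j
    by_cases hj : j ≤ M
    · obtain ⟨w, h1, h2⟩ := hd.geodesic 1 y (j * L) (by rw [hy]; exact Nat.mul_le_mul_right _ hj)
      exact ⟨w, fun _ => ⟨h1, by omega⟩⟩
    · exact ⟨1, fun h => absurd h hj⟩
  choose w hw using hw
  choose z hz hzu hzv using fun j => hleg n (w j)⁻¹ ((w j)⁻¹ * y)
  choose q h0 hq' hq using fun j => hd.exists_geodesic_path n 1 (z j) (hz j)
  let P : ℕ × ℕ → Γ := fun jt => w jt.1 * q jt.1 jt.2
  -- The distances of the point at time `t` of the `j`-th leg to the two ends of the geodesic.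
  have hP : ∀ j t, j ≤ M → t ≤ n →
      d 1 (P (j, t)) ≤ j * L + t ∧ j * L + t ≤ d 1 (P (j, t)) + (3 * k + 1) ∧
      d y (P (j, t)) + j * L ≤ n + t ∧ n + t ≤ d y (P (j, t)) + j * L + (3 * k + 1) := by
    intro j t hj ht
    have a1 := hq j 0 t (Nat.zero_le _) ht
    have a2 := hq j t n ht le_rfl
    rw [h0] at a1
    rw [hq'] at a2
    obtain ⟨b1, b2⟩ := hw j hj
    have b3 : d 1 (w j)⁻¹ = j * L := by
      rw [← b1, ← hd.left_inv (w j), mul_one, mul_inv_cancel, hd.comm]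
    have b4 : d 1 ((w j)⁻¹ * y) = d (w j) y := hd.dist_one_inv_mul _ _
    have c1 : d 1 (P (j, t)) = d (w j)⁻¹ (q j t) := by
      simp only [P]; rw [hd.dist_mul_right, mul_one]
    have c2 : d y (P (j, t)) = d ((w j)⁻¹ * y) (q j t) := hd.dist_mul_right _ _ _
    have e1 := hzu j
    have e2 := hzv j
    have e3 := hd.triangle (w j)⁻¹ (q j t) (z j)
    have e4 := hd.triangle ((w j)⁻¹ * y) (q j t) (z j)
    have e5 := hd.triangle (w j)⁻¹ 1 (q j t)
    have e6 := hd.triangle ((w j)⁻¹ * y) 1 (q j t)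
    have e7 := hd.comm (w j)⁻¹ 1
    have e8 := hd.comm ((w j)⁻¹ * y) 1
    rw [c1, c2]
    omega
  have hinj : Set.InjOn P (Finset.range (M + 1) ×ˢ Finset.range (n + 1) : Finset (ℕ × ℕ)) := by
    rintro ⟨j, t⟩ hjt ⟨i, s⟩ his h
    simp only [Finset.coe_product, Finset.coe_range, Set.mem_prod, Set.mem_Iio] at hjt his
    have h1 := hP j t (by omega) (by omega)
    have h2 := hP i s (by omega) (by omega)
    rw [h] at h1
    have hji : j = i := by
      rcases lt_trichotomy j i with hlt | heq | hlt
      · have : (j + 1) * L ≤ i * L := Nat.mul_le_mul_right _ hlt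
        rw [add_mul, one_mul] at this
        simp only [L] at *
        omega
      · exact heq
      · have : (i + 1) * L ≤ j * L := Nat.mul_le_mul_right _ hlt
        rw [add_mul, one_mul] at this
        simp only [L] at *
        omega
    subst hji
    have h3 : q j t = q j s := mul_left_cancel h
    have h4 := hq j 0 t (Nat.zero_le _) (by omega)
    have h5 := hq j 0 s (Nat.zero_le _) (by omega)
    rw [h3] at h4
    have : t = s := by omega
    rw [this]
  refine ⟨2 * n, lt_of_lt_of_le ?_ (Finset.card_le_card_of_injOn P ?_ hinj)⟩
  · rw [Finset.card_product, Finset.card_range, Finset.card_range]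
    simp only [M]
    nlinarith
  · rintro ⟨j, t⟩ hjt
    simp only [Finset.coe_product, Finset.coe_range, Set.mem_prod, Set.mem_Iio] at hjt
    have h1 := hP j t (by omega) (by omega)
    have : j * L ≤ n := Nat.mul_le_mul_right _ (by omega : j ≤ M)
    simp only [Finset.mem_coe, hd.mem_ball]
    omega

/-- Given directions `u`, `v` and an element `x`, one can turn `x` by an element `a` of a fixed ball
so that `a * x` avoids both directions. Otherwise, for every `a` in the ball, `a * x'` would be near
a geodesic from `1` to `u` or to `v`, where `x'` is the point at some fixed distance of `1` on the
way to `x`; this leaves only linearly many possibilities for `a`. -/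
lemma IsHyperbolicMetric.exists_turn (hd : IsHyperbolicMetric d k)
    (hgrow : ∀ c, ∃ B, c * (B + 1) < (hd.ball B).card) :
    ∃ B C, ∀ u v x, ∃ a, d 1 a ≤ B ∧ d 1 u + d 1 (a * x) ≤ d u (a * x) + C ∧
      d 1 v + d 1 (a * x) ≤ d v (a * x) + C := by
  classical
  let V := (hd.ball (3 * k)).card
  obtain ⟨B, hB⟩ := hgrow (2 * V * (k + 2))
  let t := B + k + 1
  -- The Gromov product of `u` and `a * x` is to be larger than `|a * x'| ≤ B + t`.
  refine ⟨B, 2 * (B + t) + k, fun u v x => ?_⟩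
  by_contra! hcon
  have hx : t ≤ d 1 x := by
    by_contra! hlt
    have h1 := hcon 1 (by rw [hd.self]; omega)
    rw [one_mul] at h1
    have := hd.triangle 1 x u
    have := hd.triangle 1 x v
    have := hd.comm u x
    have := hd.comm v x
    by_cases h : d 1 u + d 1 x ≤ d u x + (2 * (B + t) + k)
    · have := h1 h
      omega
    · omega
  obtain ⟨x', hx', hxb⟩ := hd.geodesic 1 x t hx
  have hseg : ∀ u : Γ, ∃ s : ℕ → Γ, ∀ i, i ≤ d 1 u → d 1 (s i) = i ∧
      d 1 (s i) + d (s i) u = d 1 u := by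
    intro u
    choose! s hs using hd.geodesic 1 u
    exact ⟨s, hs⟩
  choose s hs using hseg
  have key : ∀ u a, d 1 a ≤ B → d u (a * x) + (2 * (B + t) + k) < d 1 u + d 1 (a * x) →
      d 1 (a * x') ≤ B + t ∧ d (s u (d 1 (a * x'))) (a * x') ≤ 3 * k := by
    intro u a ha hu
    have l1 := hd.left_inv a 1 x'
    have l2 := hd.left_inv a 1 x
    have l3 := hd.left_inv a x' x
    rw [mul_one] at l1 l2
    have t1 := hd.triangle 1 a (a * x')
    -- `a * x'` is nearly between `1` and `a * x`, because `t` exceeds the length of `a`.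
    have f1 := hd.four_point 1 (a * x') (a * x) a
    have m1 := hd.comm (a * x) a
    have m2 := hd.comm (a * x') a
    -- `a * x'` is nearly between `1` and `u`.
    have f2 := hd.four_point (a * x') u (a * x) 1
    have m3 := hd.comm (a * x) 1
    have m4 := hd.comm u 1
    have m5 := hd.comm (a * x') 1
    have m6 := hd.comm u (a * x')
    have t2 := hd.triangle 1 (a * x') u
    have t3 := hd.triangle 1 u (a * x)
    have g := hs u (d 1 (a * x')) (by omega)
    have f3 := hd.four_point (s u (d 1 (a * x'))) (a * x') 1 u
    have m7 := hd.comm (s u (d 1 (a * x'))) 1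
    omega
  let Φ : (Bool × ℕ) × Γ → Γ := fun p => s (if p.1.1 then u else v) p.1.2 * p.2 * x'⁻¹
  have hsub : hd.ball B ⊆
      ((Finset.univ ×ˢ Finset.range (B + t + 1)) ×ˢ hd.ball (3 * k)).image Φ := by
    intro a ha
    rw [hd.mem_ball] at ha
    rw [Finset.mem_image]
    by_cases h : d 1 u + d 1 (a * x) ≤ d u (a * x) + (2 * (B + t) + k)
    · obtain ⟨h1, h2⟩ := key v a ha (hcon a ha h)
      refine ⟨((false, d 1 (a * x')), (s v (d 1 (a * x')))⁻¹ * (a * x')), ?_, ?_⟩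
      · simp only [Finset.mem_product, Finset.mem_univ, Finset.mem_range, hd.mem_ball,
          hd.dist_one_inv_mul, true_and]
        exact ⟨by omega, h2⟩
      · simp [Φ]
    · obtain ⟨h1, h2⟩ := key u a ha (not_le.1 h)
      refine ⟨((true, d 1 (a * x')), (s u (d 1 (a * x')))⁻¹ * (a * x')), ?_, ?_⟩
      · simp only [Finset.mem_product, Finset.mem_univ, Finset.mem_range, hd.mem_ball,
          hd.dist_one_inv_mul, true_and]
        exact ⟨by omega, h2⟩
      · simp [Φ]
  have hcard := (Finset.card_le_card hsub).trans Finset.card_image_le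
  rw [Finset.card_product, Finset.card_product, Finset.card_range, Finset.card_univ,
    Fintype.card_bool] at hcard
  have hle : 2 * (B + t + 1) * V ≤ 2 * V * (k + 2) * (B + 1) := by
    have : B + t + 1 ≤ (k + 2) * (B + 1) := by simp only [t]; nlinarith [Nat.zero_le (k * B)]
    calc 2 * (B + t + 1) * V = 2 * V * (B + t + 1) := by ring
      _ ≤ 2 * V * ((k + 2) * (B + 1)) := Nat.mul_le_mul_left _ this
      _ = _ := by ring
  exact absurd (hB.trans_le (hcard.trans hle)) (lt_irrefl _)

end Growth

/-! ### Transition probabilities, Green function and first visits -/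

section Transition

variable {Γ : Type*} [Group Γ] (μ : PMF Γ)

lemma transition_mul_left (n : ℕ) (g x y : Γ) :
    transition μ n (g * x) (g * y) = transition μ n x y := by
  induction n generalizing y with
  | zero => by_cases h : y = x <;> simp [transition, h]
  | succ n ih =>
    simp only [transition]
    rw [← (Equiv.mulLeft g).tsum_eq]
    refine tsum_congr fun z => ?_
    simp only [Equiv.coe_mulLeft, ih]
    congr 2
    group

lemma transition_one (x y : Γ) : transition μ 1 x y = μ (x⁻¹ * y) := by
  simp only [transition]
  rw [tsum_eq_single x]
  · simp
  · intro z hz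
    simp [hz]

lemma transition_zero_self (x : Γ) : transition μ 0 x x = 1 := by simp [transition]

lemma transition_zero_of_ne {x y : Γ} (h : x ≠ y) : transition μ 0 x y = 0 := by
  simp [transition, h.symm]

lemma transition_add (m n : ℕ) (x y : Γ) :
    transition μ (m + n) x y = ∑' z, transition μ m x z * transition μ n z y := by
  induction n generalizing y with
  | zero =>
    rw [tsum_eq_single y]
    · simp [transition]
    · intro z hz
      rw [transition_zero_of_ne μ hz, mul_zero]
  | succ n ih =>
    rw [← add_assoc]
    simp only [transition, ih, ← ENNReal.tsum_mul_right, ← ENNReal.tsum_mul_left]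
    rw [ENNReal.tsum_comm]
    exact tsum_congr fun z => tsum_congr fun w => mul_assoc _ _ _

lemma transition_succ' (n : ℕ) (x y : Γ) :
    transition μ (n + 1) x y = ∑' z, μ (x⁻¹ * z) * transition μ n z y := by
  rw [add_comm, transition_add]
  simp only [transition_one]

lemma transition_mul_le (m n : ℕ) (x z y : Γ) :
    transition μ m x z * transition μ n z y ≤ transition μ (m + n) x y := by
  rw [transition_add]
  exact ENNReal.le_tsum z

lemma tsum_transition (n : ℕ) (x : Γ) : ∑' y, transition μ n x y = 1 := by
  induction n with
  | zero =>
    rw [tsum_eq_single x]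
    · exact transition_zero_self μ x
    · intro z hz
      exact transition_zero_of_ne μ hz.symm
  | succ n ih =>
    simp only [transition]
    rw [ENNReal.tsum_comm, ← ih]
    refine tsum_congr fun z => ?_
    rw [ENNReal.tsum_mul_left, ← (Equiv.mulLeft z).tsum_eq]
    simp [μ.tsum_coe]

lemma transition_le_one (n : ℕ) (x y : Γ) : transition μ n x y ≤ 1 :=
  (tsum_transition μ n x) ▸ ENNReal.le_tsum y

lemma transition_ne_top (n : ℕ) (x y : Γ) : transition μ n x y ≠ ∞ :=
  ne_top_of_le_ne_top ENNReal.one_ne_top (transition_le_one μ n x y)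

variable {μ} in
lemma IsAdmissible.exists_transition_ne_zero (hadm : IsAdmissible μ) (x y : Γ) :
    ∃ n, transition μ n x y ≠ 0 := by
  have key : ∀ g : Γ, ∃ n, transition μ n 1 g ≠ 0 := by
    intro g
    have hg : g ∈ Subsemigroup.closure μ.support := hadm ▸ Subsemigroup.mem_top g
    induction hg using Subsemigroup.closure_induction with
    | mem g hg => exact ⟨1, by simpa [transition_one] using hg⟩
    | mul g h _ _ ihg ihh =>
      obtain ⟨m, hm⟩ := ihg
      obtain ⟨n, hn⟩ := ihh
      refine ⟨m + n, fun h0 => ?_⟩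
      have h1 := transition_mul_le μ m n 1 g (g * h)
      rw [h0, ← transition_mul_left μ n g 1 h, mul_one] at *
      exact (mul_ne_zero hm hn) (le_antisymm h1 bot_le)
  obtain ⟨n, hn⟩ := key (x⁻¹ * y)
  refine ⟨n, ?_⟩
  rwa [← transition_mul_left μ n x, mul_one, mul_inv_cancel_left] at hn

end Transition

section Green

lemma tsum_sum_antidiagonal (f : ℕ → ℕ → ℝ≥0∞) :
    ∑' n, ∑ p ∈ Finset.HasAntidiagonal.antidiagonal n, f p.1 p.2 = ∑' i, ∑' j, f i j := by
  rw [← ENNReal.tsum_prod, ← Finset.HasAntidiagonal.sigmaAntidiagonalEquivProd.tsum_eq, ENNReal.tsum_sigma']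
  refine tsum_congr fun n => ?_
  rw [tsum_fintype, ← Finset.sum_coe_sort]
  rfl

variable {Γ : Type*} [Group Γ] (μ : PMF Γ)

lemma green_mul_left (r : ℝ) (g x y : Γ) : green μ r (g * x) (g * y) = green μ r x y := by
  simp only [green, transition_mul_left]

lemma green_self_eq (r : ℝ) (x : Γ) : green μ r x x = green μ r 1 1 := by
  simpa using green_mul_left μ r x 1 1

lemma greenH_mul_left (r : ℝ) (g x y : Γ) : greenH μ r (g * x) (g * y) = greenH μ r x y := by
  simp only [greenH, green_mul_left]

lemma one_le_green_self (r : ℝ) (x : Γ) : 1 ≤ green μ r x x := by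
  refine le_trans ?_ (ENNReal.le_tsum 0)
  simp [transition_zero_self]

lemma transition_mul_green_le (r : ℝ) (n : ℕ) (x w y : Γ) :
    ENNReal.ofReal r ^ n * transition μ n x w * green μ r w y ≤ green μ r x y := by
  rw [green, ← ENNReal.tsum_mul_left]
  calc _ ≤ ∑' m, ENNReal.ofReal r ^ (n + m) * transition μ (n + m) x y := by
        refine ENNReal.tsum_le_tsum fun m => ?_
        calc _ = ENNReal.ofReal r ^ (n + m) * (transition μ n x w * transition μ m w y) := by
              rw [pow_add]; ring
          _ ≤ _ := by gcongr; exact transition_mul_le μ n m x w y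
    _ ≤ _ := ENNReal.tsum_comp_le_tsum_of_injective (add_right_injective n)
        (fun m => ENNReal.ofReal r ^ m * transition μ m x y)

lemma green_mul_transition_le (r : ℝ) (n : ℕ) (x w y : Γ) :
    green μ r x w * (ENNReal.ofReal r ^ n * transition μ n w y) ≤ green μ r x y := by
  rw [green, ← ENNReal.tsum_mul_right]
  calc _ ≤ ∑' m, ENNReal.ofReal r ^ (m + n) * transition μ (m + n) x y := by
        refine ENNReal.tsum_le_tsum fun m => ?_
        calc _ = ENNReal.ofReal r ^ (m + n) * (transition μ m x w * transition μ n w y) := by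
              rw [pow_add]; ring
          _ ≤ _ := by gcongr; exact transition_mul_le μ m n x w y
    _ ≤ _ := ENNReal.tsum_comp_le_tsum_of_injective (add_left_injective n)
        (fun m => ENNReal.ofReal r ^ m * transition μ m x y)

variable {μ} in
lemma IsAdmissible.green_ne_zero (hadm : IsAdmissible μ) {r : ℝ} (hr : 0 < r) (x y : Γ) :
    green μ r x y ≠ 0 := by
  obtain ⟨n, hn⟩ := hadm.exists_transition_ne_zero x y
  refine fun h => ?_
  have := ENNReal.tsum_eq_zero.1 h n
  simp [hn, hr.not_ge] at this

lemma tsum_green_mul_green (r : ℝ) (x y : Γ) :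
    ∑' z, green μ r x z * green μ r z y =
      ∑' n : ℕ, ENNReal.ofReal r ^ n * ((n + 1) * transition μ n x y) := by
  calc _ = ∑' z, ∑' i : ℕ, ∑' j : ℕ, ENNReal.ofReal r ^ (i + j) *
          (transition μ i x z * transition μ j z y) := by
        refine tsum_congr fun z => ?_
        simp only [green]
        rw [← ENNReal.tsum_mul_right]
        refine tsum_congr fun i => ?_
        rw [← ENNReal.tsum_mul_left]
        refine tsum_congr fun j => ?_
        rw [pow_add]; ring
    _ = ∑' i : ℕ, ∑' j : ℕ, ENNReal.ofReal r ^ (i + j) * transition μ (i + j) x y := by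
        rw [ENNReal.tsum_comm]
        refine tsum_congr fun i => ?_
        rw [ENNReal.tsum_comm]
        refine tsum_congr fun j => ?_
        rw [ENNReal.tsum_mul_left, transition_add]
    _ = _ := by
        rw [← tsum_sum_antidiagonal
          (fun i j => ENNReal.ofReal r ^ (i + j) * transition μ (i + j) x y)]
        refine tsum_congr fun n => ?_
        rw [Finset.sum_congr rfl (g := fun _ => ENNReal.ofReal r ^ n * transition μ n x y)]
        · rw [Finset.sum_const, Finset.Nat.card_antidiagonal, nsmul_eq_mul]
          push_cast
          ring
        · intro p hp
          rw [Finset.HasAntidiagonal.mem_antidiagonal.1 hp]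

lemma eta_eq_tsum (r : ℝ) :
    eta μ r = ∑' n : ℕ, ENNReal.ofReal r ^ n * ((n + 1) * transition μ n 1 1) :=
  tsum_green_mul_green μ r 1 1

lemma two_mul_sum_antidiagonal (n : ℕ) :
    2 * ∑ p ∈ Finset.HasAntidiagonal.antidiagonal n, ((p.1 : ℝ≥0∞) + 1) = (n + 1) * (n + 2) := by
  have h : ∀ n : ℕ, 2 * ∑ p ∈ Finset.HasAntidiagonal.antidiagonal n, (p.1 + 1) = (n + 1) * (n + 2) := by
    intro n
    rw [Finset.Nat.sum_antidiagonal_eq_sum_range_succ (fun i _ => i + 1)]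
    induction n with
    | zero => rfl
    | succ n ih => rw [Finset.sum_range_succ, mul_add, ih]; ring
  exact_mod_cast congrArg (Nat.cast (R := ℝ≥0∞)) (h n)

lemma two_mul_tsum_green_triple (r : ℝ) :
    2 * ∑' (x : Γ) (y : Γ), green μ r 1 y * green μ r y x * green μ r x 1 =
      ∑' n : ℕ, ENNReal.ofReal r ^ n * ((n + 1) * (n + 2) * transition μ n 1 1) := by
  have h1 : ∑' (x : Γ) (y : Γ), green μ r 1 y * green μ r y x * green μ r x 1 =
      ∑' (x : Γ) (i : ℕ) (j : ℕ), ENNReal.ofReal r ^ (i + j) *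
          ((i + 1) * (transition μ i 1 x * transition μ j x 1)) := by
    refine tsum_congr fun x => ?_
    rw [ENNReal.tsum_mul_right, tsum_green_mul_green]
    simp only [green]
    rw [← ENNReal.tsum_mul_right]
    refine tsum_congr fun i => ?_
    rw [← ENNReal.tsum_mul_left]
    refine tsum_congr fun j => ?_
    rw [pow_add]; ring
  have h2 : ∑' (x : Γ) (i : ℕ) (j : ℕ), ENNReal.ofReal r ^ (i + j) *
          ((i + 1) * (transition μ i 1 x * transition μ j x 1)) =
      ∑' (i : ℕ) (j : ℕ), ENNReal.ofReal r ^ (i + j) * ((i + 1) * transition μ (i + j) 1 1) := by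
    rw [ENNReal.tsum_comm]
    refine tsum_congr fun i => ?_
    rw [ENNReal.tsum_comm]
    refine tsum_congr fun j => ?_
    rw [ENNReal.tsum_mul_left, ENNReal.tsum_mul_left, transition_add]
  rw [h1, h2, ← tsum_sum_antidiagonal
    (fun i j => ENNReal.ofReal r ^ (i + j) * ((i + 1) * transition μ (i + j) 1 1)),
    ← ENNReal.tsum_mul_left]
  refine tsum_congr fun n => ?_
  rw [← two_mul_sum_antidiagonal]
  rw [Finset.sum_congr rfl (g := fun p : ℕ × ℕ =>
    ((p.1 : ℝ≥0∞) + 1) * (ENNReal.ofReal r ^ n * transition μ n 1 1))]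
  · rw [← Finset.sum_mul]
    ring
  · intro p hp
    rw [Finset.HasAntidiagonal.mem_antidiagonal.1 hp]
    ring

/-- `firstHit μ y n x` is the probability that the random walk from `x` visits `y` for the first
time at time `n`. -/
noncomputable def firstHit (y : Γ) : ℕ → Γ → ℝ≥0∞
  | 0, x => Set.indicator {y} 1 x
  | n + 1, x => Set.indicator {y}ᶜ (fun x => ∑' z, μ (x⁻¹ * z) * firstHit y n z) x

/-- The generating function `F_r(x, y)` of the first visit to `y` from `x`. -/
noncomputable def hitGreen (r : ℝ) (x y : Γ) : ℝ≥0∞ :=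
  ∑' n : ℕ, ENNReal.ofReal r ^ n * firstHit μ y n x

lemma firstHit_zero_self (y : Γ) : firstHit μ y 0 y = 1 := by simp [firstHit]

lemma firstHit_zero_of_ne {x y : Γ} (h : x ≠ y) : firstHit μ y 0 x = 0 := by simp [firstHit, h]

lemma firstHit_succ_self (y : Γ) (n : ℕ) : firstHit μ y (n + 1) y = 0 := by simp [firstHit]

lemma firstHit_succ_of_ne {x y : Γ} (h : x ≠ y) (n : ℕ) :
    firstHit μ y (n + 1) x = ∑' z, μ (x⁻¹ * z) * firstHit μ y n z := by simp [firstHit, h]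

lemma hitGreen_self (r : ℝ) (y : Γ) : hitGreen μ r y y = 1 := by
  rw [hitGreen, tsum_eq_single 0]
  · simp [firstHit_zero_self]
  · intro n hn
    obtain ⟨n, rfl⟩ := Nat.exists_eq_succ_of_ne_zero hn
    simp [firstHit_succ_self]

lemma sum_firstHit_self (y z : Γ) (n : ℕ) :
    ∑ p ∈ Finset.HasAntidiagonal.antidiagonal n, firstHit μ y p.1 y * transition μ p.2 y z =
      transition μ n y z := by
  cases n with
  | zero => simp [firstHit_zero_self]
  | succ n => rw [Finset.Nat.sum_antidiagonal_succ]; simp [firstHit_zero_self, firstHit_succ_self]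

lemma sum_firstHit_succ {x y : Γ} (h : x ≠ y) (z : Γ) (n : ℕ) :
    ∑ p ∈ Finset.HasAntidiagonal.antidiagonal (n + 1), firstHit μ y p.1 x * transition μ p.2 y z =
      ∑' w, μ (x⁻¹ * w) *
        ∑ p ∈ Finset.HasAntidiagonal.antidiagonal n, firstHit μ y p.1 w * transition μ p.2 y z := by
  rw [Finset.Nat.sum_antidiagonal_succ]
  simp only [firstHit_zero_of_ne μ h, firstHit_succ_of_ne μ h, zero_mul, zero_add, Finset.mul_sum]
  rw [Summable.tsum_finsetSum fun _ _ => ENNReal.summable]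
  refine Finset.sum_congr rfl fun p _ => ?_
  rw [← ENNReal.tsum_mul_right]
  exact tsum_congr fun w => mul_assoc _ _ _

/-- Decomposition of the trajectories from `x` to `z` through `y`, at the first visit of `y`. -/
lemma sum_firstHit_le (y z : Γ) (n : ℕ) (x : Γ) :
    ∑ p ∈ Finset.HasAntidiagonal.antidiagonal n, firstHit μ y p.1 x * transition μ p.2 y z ≤
      transition μ n x z := by
  induction n generalizing x with
  | zero =>
    by_cases h : x = y
    · rw [h, sum_firstHit_self]
    · simp [firstHit_zero_of_ne μ h]
  | succ n ih =>
    by_cases h : x = y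
    · rw [h, sum_firstHit_self]
    · rw [sum_firstHit_succ μ h, transition_succ']
      gcongr with w
      exact ih w

lemma sum_firstHit_eq (y : Γ) (n : ℕ) (x : Γ) :
    ∑ p ∈ Finset.HasAntidiagonal.antidiagonal n, firstHit μ y p.1 x * transition μ p.2 y y =
      transition μ n x y := by
  induction n generalizing x with
  | zero =>
    by_cases h : x = y
    · rw [h, sum_firstHit_self]
    · simp [firstHit_zero_of_ne μ h, transition_zero_of_ne μ h]
  | succ n ih =>
    by_cases h : x = y
    · rw [h, sum_firstHit_self]
    · rw [sum_firstHit_succ μ h, transition_succ']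
      simp only [ih]

lemma firstHit_le_transition (y : Γ) (n : ℕ) (x : Γ) : firstHit μ y n x ≤ transition μ n x y := by
  rw [← sum_firstHit_eq]
  calc firstHit μ y n x = firstHit μ y n x * transition μ 0 y y := by
        rw [transition_zero_self, mul_one]
    _ ≤ _ := Finset.single_le_sum (f := fun p : ℕ × ℕ => firstHit μ y p.1 x * transition μ p.2 y y)
        (a := (n, 0)) (fun _ _ => bot_le) (Finset.HasAntidiagonal.mem_antidiagonal.2 (add_zero n))

lemma hitGreen_mul_green (r : ℝ) (x y z : Γ) :
    hitGreen μ r x y * green μ r y z = ∑' n, ENNReal.ofReal r ^ n *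
      ∑ p ∈ Finset.HasAntidiagonal.antidiagonal n, firstHit μ y p.1 x * transition μ p.2 y z := by
  calc _ = ∑' (i : ℕ) (j : ℕ), ENNReal.ofReal r ^ (i + j) *
        (firstHit μ y i x * transition μ j y z) := by
        rw [hitGreen, ← ENNReal.tsum_mul_right]
        refine tsum_congr fun i => ?_
        rw [green, ← ENNReal.tsum_mul_left]
        refine tsum_congr fun j => ?_
        rw [pow_add]; ring
    _ = _ := by
        rw [← tsum_sum_antidiagonal
          (fun i j => ENNReal.ofReal r ^ (i + j) * (firstHit μ y i x * transition μ j y z))]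
        refine tsum_congr fun n => ?_
        rw [Finset.mul_sum]
        refine Finset.sum_congr rfl fun p hp => ?_
        rw [Finset.HasAntidiagonal.mem_antidiagonal.1 hp]

lemma hitGreen_mul_green_le (r : ℝ) (x y z : Γ) :
    hitGreen μ r x y * green μ r y z ≤ green μ r x z := by
  rw [hitGreen_mul_green, green]
  gcongr with n
  exact sum_firstHit_le μ y z n x

lemma hitGreen_mul_green_self (r : ℝ) (x y : Γ) :
    hitGreen μ r x y * green μ r 1 1 = green μ r x y := by
  rw [← green_self_eq μ r y, hitGreen_mul_green, green]
  simp only [sum_firstHit_eq]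

lemma green_mul_green_le (r : ℝ) (x y z : Γ) :
    green μ r x y * green μ r y z ≤ green μ r 1 1 * green μ r x z := by
  rw [← hitGreen_mul_green_self μ r x y, mul_right_comm, mul_comm]
  gcongr
  exact hitGreen_mul_green_le μ r x y z

lemma hitGreen_mul_le {r : ℝ} (hg : green μ r 1 1 ≠ ∞) (x y z : Γ) :
    hitGreen μ r x y * hitGreen μ r y z ≤ hitGreen μ r x z := by
  have h0 : green μ r 1 1 ≠ 0 := (zero_lt_one.trans_le (one_le_green_self μ r 1)).ne'
  rw [← ENNReal.mul_le_mul_iff_left h0 hg, mul_assoc, hitGreen_mul_green_self,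
    hitGreen_mul_green_self]
  exact hitGreen_mul_green_le μ r x y z

lemma green_eq_delta_add (r : ℝ) (x y : Γ) :
    green μ r x y = transition μ 0 x y +
      ENNReal.ofReal r * ∑' z, μ (x⁻¹ * z) * green μ r z y := by
  rw [green, tsum_eq_zero_add' ENNReal.summable, pow_zero, one_mul]
  congr 1
  simp only [green, ← ENNReal.tsum_mul_left]
  rw [ENNReal.tsum_comm]
  refine tsum_congr fun n => ?_
  rw [transition_succ', ← ENNReal.tsum_mul_left]
  refine tsum_congr fun z => ?_
  rw [pow_succ]; ring

lemma hitGreen_eq_of_ne (r : ℝ) {x y : Γ} (h : x ≠ y) :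
    hitGreen μ r x y = ENNReal.ofReal r * ∑' z, μ (x⁻¹ * z) * hitGreen μ r z y := by
  rw [hitGreen, tsum_eq_zero_add' ENNReal.summable, firstHit_zero_of_ne μ h, mul_zero, zero_add]
  simp only [hitGreen, ← ENNReal.tsum_mul_left]
  rw [ENNReal.tsum_comm]
  refine tsum_congr fun n => ?_
  rw [firstHit_succ_of_ne μ h, ← ENNReal.tsum_mul_left]
  refine tsum_congr fun z => ?_
  rw [pow_succ]; ring

end Green

/-! ### Power series in the return probabilities -/

section PowerSeries

lemma monotone_tsum_ofReal_pow (c : ℕ → ℝ≥0∞) :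
    Monotone fun r : ℝ => ∑' n : ℕ, ENNReal.ofReal r ^ n * c n := by
  intro r s h
  simp only
  gcongr

/-- A power series with nonnegative coefficients is left-continuous, even where it is infinite. -/
lemma tendsto_tsum_ofReal_pow (c : ℕ → ℝ≥0∞) (hc : ∀ n, c n ≠ ∞) (R : ℝ) :
    Filter.Tendsto (fun r : ℝ => ∑' n : ℕ, ENNReal.ofReal r ^ n * c n) (nhdsWithin R (Set.Iio R))
      (nhds (∑' n : ℕ, ENNReal.ofReal R ^ n * c n)) := by
  let S : ℝ → ℝ≥0∞ := fun r => ∑' n : ℕ, ENNReal.ofReal r ^ n * c n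
  have hlsc : Filter.Tendsto (fun N : ℕ => ∑ n ∈ Finset.range N, ENNReal.ofReal R ^ n * c n)
      Filter.atTop (nhds (S R)) := ENNReal.tendsto_nat_tsum _
  refine tendsto_order.2 ⟨fun b hb => ?_, fun b hb => ?_⟩
  · obtain ⟨N, hN⟩ := (hlsc.eventually (lt_mem_nhds hb)).exists
    have hcont : Continuous fun r : ℝ => ∑ n ∈ Finset.range N, ENNReal.ofReal r ^ n * c n := by
      refine continuous_finsetSum _ fun n _ => ?_
      exact (ENNReal.continuous_mul_const (hc n)).comp
        ((ENNReal.continuous_pow n).comp ENNReal.continuous_ofReal)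
    filter_upwards [(hcont.tendsto R).mono_left nhdsWithin_le_nhds |>.eventually
      (lt_mem_nhds hN)] with r hr
    exact hr.trans_le (ENNReal.sum_le_tsum _)
  · filter_upwards [self_mem_nhdsWithin] with r hr
    exact (monotone_tsum_ofReal_pow c (le_of_lt hr)).trans_lt hb

end PowerSeries

section Convergence

variable {Γ : Type*} [Group Γ] (μ : PMF Γ)

/-- The `n`-step return probability, as a real number. -/
noncomputable def returnProb (n : ℕ) : ℝ := (transition μ n 1 1).toReal

lemma returnProb_nonneg (n : ℕ) : 0 ≤ returnProb μ n := ENNReal.toReal_nonneg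

lemma ofReal_returnProb (n : ℕ) : ENNReal.ofReal (returnProb μ n) = transition μ n 1 1 :=
  ENNReal.ofReal_toReal (transition_ne_top μ n 1 1)

/-- Root test for the Green function. -/
lemma exists_returnProb_le {r : ℝ} (h0 : 0 ≤ r) (hr : r < invSpectralRadius μ) :
    ∃ s, r < s ∧ ∀ᶠ n : ℕ in Filter.atTop, returnProb μ n ≤ s⁻¹ ^ n := by
  obtain ⟨s, hrs, hsR⟩ := exists_between hr
  have hs0 : 0 < s := h0.trans_lt hrs
  refine ⟨s, hrs, ?_⟩
  have h1 : ENNReal.ofReal s <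
      (Filter.limsup (fun n : ℕ => transition μ n 1 1 ^ (1 / (n : ℝ))) Filter.atTop)⁻¹ :=
    ((ENNReal.ofReal_lt_ofReal_iff (hs0.trans hsR)).2 hsR).trans_le ENNReal.ofReal_toReal_le
  rw [ENNReal.lt_inv_iff_lt_inv] at h1
  filter_upwards [Filter.eventually_lt_of_limsup_lt h1, Filter.eventually_gt_atTop 0] with n hn hn0
  have hn0' : (n : ℝ) ≠ 0 := by positivity
  have h2 := ENNReal.rpow_le_rpow hn.le (Nat.cast_nonneg (α := ℝ) n)
  rw [← ENNReal.rpow_mul, one_div, inv_mul_cancel₀ hn0', ENNReal.rpow_one, ENNReal.rpow_natCast,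
    ← ENNReal.ofReal_inv_of_pos hs0, ← ENNReal.ofReal_pow (by positivity)] at h2
  exact ENNReal.toReal_le_of_le_ofReal (by positivity) h2

lemma summable_returnProb {r : ℝ} (h0 : 0 ≤ r) (hr : r < invSpectralRadius μ) :
    Summable fun n : ℕ => r ^ n * ((n + 1) * (n + 2) * returnProb μ n) := by
  obtain ⟨s, hrs, hs⟩ := exists_returnProb_le μ h0 hr
  have hs0 : 0 < s := h0.trans_lt hrs
  have hq : ‖r / s‖ < 1 := by
    rw [Real.norm_of_nonneg (by positivity)]
    exact (div_lt_one hs0).2 hrs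
  have hsum : Summable fun n : ℕ => 6 * ((n : ℝ) ^ 2 * (r / s) ^ n) :=
    (summable_pow_mul_geometric_of_norm_lt_one 2 hq).mul_left 6
  refine hsum.of_norm_bounded_eventually_nat ?_
  filter_upwards [hs, Filter.eventually_ge_atTop 1] with n hn hn1
  have hn1' : (1 : ℝ) ≤ n := by exact_mod_cast hn1
  have hp := returnProb_nonneg μ n
  rw [Real.norm_of_nonneg (by positivity)]
  calc r ^ n * ((n + 1) * (n + 2) * returnProb μ n)
      ≤ r ^ n * ((6 * (n : ℝ) ^ 2) * s⁻¹ ^ n) := by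
        have h6 : ((n : ℝ) + 1) * (n + 2) ≤ 6 * (n : ℝ) ^ 2 := by nlinarith
        exact mul_le_mul_of_nonneg_left (mul_le_mul h6 hn hp (by positivity)) (by positivity)
    _ = 6 * ((n : ℝ) ^ 2 * (r / s) ^ n) := by rw [div_eq_mul_inv, mul_pow]; ring

lemma summable_eta {r : ℝ} (h0 : 0 ≤ r) (hr : r < invSpectralRadius μ) :
    Summable fun n : ℕ => r ^ n * ((n + 1) * returnProb μ n) := by
  refine (summable_returnProb μ h0 hr).of_nonneg_of_le (fun n => ?_) fun n => ?_
  · have := returnProb_nonneg μ n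
    positivity
  · have := returnProb_nonneg μ n
    gcongr
    nlinarith [Nat.cast_nonneg (α := ℝ) n]

lemma eta_eq_ofReal {r : ℝ} (h0 : 0 ≤ r) (hr : r < invSpectralRadius μ) :
    eta μ r = ENNReal.ofReal (∑' n : ℕ, r ^ n * ((n + 1) * returnProb μ n)) := by
  rw [eta_eq_tsum, ENNReal.ofReal_tsum_of_nonneg (fun n => ?_) (summable_eta μ h0 hr)]
  · refine tsum_congr fun n => ?_
    rw [ENNReal.ofReal_mul (by positivity), ENNReal.ofReal_mul (by positivity), ofReal_returnProb,
      ENNReal.ofReal_pow h0, ENNReal.ofReal_add (by positivity) zero_le_one, ENNReal.ofReal_natCast,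
      ENNReal.ofReal_one]
  · have := returnProb_nonneg μ n
    positivity

lemma two_mul_triple_eq_ofReal {r : ℝ} (h0 : 0 ≤ r) (hr : r < invSpectralRadius μ) :
    2 * ∑' (x : Γ) (y : Γ), green μ r 1 y * green μ r y x * green μ r x 1 =
      ENNReal.ofReal (∑' n : ℕ, r ^ n * ((n + 1) * (n + 2) * returnProb μ n)) := by
  rw [two_mul_tsum_green_triple,
    ENNReal.ofReal_tsum_of_nonneg (fun n => ?_) (summable_returnProb μ h0 hr)]
  · refine tsum_congr fun n => ?_
    have e2 : ENNReal.ofReal ((n : ℝ) + 2) = n + 2 := by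
      rw [ENNReal.ofReal_add (by positivity) zero_le_two, ENNReal.ofReal_natCast,
        ENNReal.ofReal_ofNat]
    rw [ENNReal.ofReal_mul (by positivity), ENNReal.ofReal_mul (by positivity), ofReal_returnProb,
      ENNReal.ofReal_mul (by positivity), e2,
      ENNReal.ofReal_pow h0, ENNReal.ofReal_add (by positivity) zero_le_one, ENNReal.ofReal_natCast,
      ENNReal.ofReal_one]
  · have := returnProb_nonneg μ n
    positivity

lemma eta_ne_top {r : ℝ} (h0 : 0 ≤ r) (hr : r < invSpectralRadius μ) : eta μ r ≠ ∞ := by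
  rw [eta_eq_ofReal μ h0 hr]
  exact ENNReal.ofReal_ne_top

lemma one_le_eta (r : ℝ) : 1 ≤ eta μ r := by
  refine le_trans ?_ (ENNReal.le_tsum 1)
  exact one_le_mul (one_le_green_self μ r 1) (one_le_green_self μ r 1)

lemma green_self_le_eta (r : ℝ) : green μ r 1 1 ≤ eta μ r := by
  refine le_trans ?_ (ENNReal.le_tsum 1)
  exact le_mul_of_one_le_right bot_le (one_le_green_self μ r 1)

lemma green_self_ne_top {r : ℝ} (h0 : 0 ≤ r) (hr : r < invSpectralRadius μ) :
    green μ r 1 1 ≠ ∞ :=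
  ne_top_of_le_ne_top (eta_ne_top μ h0 hr) (green_self_le_eta μ r)

lemma tendsto_hitGreen (R : ℝ) (x y : Γ) :
    Filter.Tendsto (fun r => hitGreen μ r x y) (nhdsWithin R (Set.Iio R))
      (nhds (hitGreen μ R x y)) :=
  tendsto_tsum_ofReal_pow _
    (fun n => ne_top_of_le_ne_top (transition_ne_top μ n x y) (firstHit_le_transition μ y n x)) R

lemma tendsto_eta (R : ℝ) :
    Filter.Tendsto (fun r => eta μ r) (nhdsWithin R (Set.Iio R)) (nhds (eta μ R)) := by
  simp only [eta_eq_tsum]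
  refine tendsto_tsum_ofReal_pow _ (fun n => ?_) R
  exact ENNReal.mul_ne_top (by finiteness) (transition_ne_top μ n 1 1)

lemma monotone_green (x y : Γ) : Monotone fun r => green μ r x y :=
  monotone_tsum_ofReal_pow _

end Convergence

/-! ### Finiteness of the Green function at the spectral radius -/

section Recurrence

variable {Γ : Type*} [Group Γ] (μ : PMF Γ)

/-- `v` is superharmonic for `t` times the transition operator. -/
def IsSuperharmonic (t : ℝ≥0∞) (v : Γ → ℝ≥0∞) : Prop :=
  ∀ x, t * ∑' z, μ (x⁻¹ * z) * v z ≤ v x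

variable {μ}

/-- The Riesz decomposition: the potential of the charge `v - t P v` is at most `v`, so an infinite
Green function leaves no room for a charge. -/
lemma IsSuperharmonic.harmonic {R : ℝ} {v : Γ → ℝ≥0∞}
    (hv : IsSuperharmonic μ (ENNReal.ofReal R) v) (hfin : ∀ x, v x ≠ ∞)
    (hg : green μ R 1 1 = ∞) (x : Γ) : ENNReal.ofReal R * ∑' z, μ (x⁻¹ * z) * v z = v x := by
  set t := ENNReal.ofReal R
  let c : Γ → ℝ≥0∞ := fun y => v y - t * ∑' z, μ (y⁻¹ * z) * v z
  have hc : ∀ y, t * ∑' z, μ (y⁻¹ * z) * v z + c y = v y := fun y => add_tsub_cancel_of_le (hv y)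
  have key : ∀ N y, (∑ n ∈ Finset.range N, t ^ n * transition μ n y x) * c x ≤ v y := by
    intro N
    induction N with
    | zero => intro y; simp
    | succ N ih =>
      intro y
      rw [Finset.sum_range_succ', add_mul, ← hc y]
      refine add_le_add ?_ ?_
      · calc _ = t * ∑' z, μ (y⁻¹ * z) *
              ((∑ n ∈ Finset.range N, t ^ n * transition μ n z x) * c x) := by
              simp only [transition_succ', ← mul_assoc, ENNReal.tsum_mul_right]
              congr 1
              simp only [Finset.mul_sum]
              rw [Summable.tsum_finsetSum fun _ _ => ENNReal.summable, Finset.mul_sum]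
              refine Finset.sum_congr rfl fun n _ => ?_
              rw [pow_succ, ← ENNReal.tsum_mul_left, ← ENNReal.tsum_mul_left]
              refine tsum_congr fun z => ?_
              ring
          _ ≤ _ := by gcongr with z; exact ih z
      · by_cases h : y = x
        · simp [h, transition_zero_self]
        · simp [transition_zero_of_ne μ h]
  have hle : green μ R x x * c x ≤ v x := by
    rw [green, ENNReal.tsum_eq_iSup_nat, ENNReal.iSup_mul]
    exact iSup_le fun N => key N x
  rw [green_self_eq, hg] at hle
  have hcx : c x = 0 := by
    by_contra h
    rw [ENNReal.top_mul h] at hle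
    exact hfin x (top_le_iff.1 hle)
  rw [← hc x, hcx, add_zero]

lemma harmonic_iterate {t : ℝ≥0∞} {v : Γ → ℝ≥0∞}
    (hv : ∀ x, t * ∑' z, μ (x⁻¹ * z) * v z = v x) (n : ℕ) (x : Γ) :
    ∑' z, t ^ n * transition μ n x z * v z = v x := by
  induction n generalizing x with
  | zero =>
    rw [tsum_eq_single x]
    · simp [transition_zero_self]
    · intro z hz
      simp [transition_zero_of_ne μ hz.symm]
  | succ n ih =>
    rw [← hv x, ← ENNReal.tsum_mul_left]
    have : ∀ w, t * (μ (x⁻¹ * w) * v w) =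
        ∑' z, t * (μ (x⁻¹ * w) * (t ^ n * transition μ n w z * v z)) := by
      intro w
      rw [ENNReal.tsum_mul_left, ENNReal.tsum_mul_left, ih w]
    simp only [this]
    rw [ENNReal.tsum_comm]
    refine tsum_congr fun z => ?_
    rw [transition_succ', ← ENNReal.tsum_mul_left, ← ENNReal.tsum_mul_right]
    refine tsum_congr fun w => ?_
    rw [pow_succ]; ring

/-- If the Green function is infinite, positive superharmonic functions are determined by their
value at one point: the minimum of two of them is superharmonic, hence harmonic, and it coincides
with the first one as soon as it does so at one point. -/
lemma IsSuperharmonic.le_of_eq_one (hadm : IsAdmissible μ) {R : ℝ} (hR : 0 < R)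
    (hg : green μ R 1 1 = ∞) {v w : Γ → ℝ≥0∞}
    (hv : IsSuperharmonic μ (ENNReal.ofReal R) v) (hw : IsSuperharmonic μ (ENNReal.ofReal R) w)
    (hvfin : ∀ x, v x ≠ ∞) (h1 : v 1 = w 1) (z : Γ) : v z ≤ w z := by
  let u : Γ → ℝ≥0∞ := fun x => min (v x) (w x)
  have hu : IsSuperharmonic μ (ENNReal.ofReal R) u := by
    refine fun x => le_min (le_trans ?_ (hv x)) (le_trans ?_ (hw x))
    · gcongr; exact min_le_left _ _
    · gcongr; exact min_le_right _ _
  have hufin : ∀ x, u x ≠ ∞ := fun x => ne_top_of_le_ne_top (hvfin x) (min_le_left _ _)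
  have hu1 : u 1 = v 1 := by simp [u, h1]
  obtain ⟨n, hn⟩ := hadm.exists_transition_ne_zero 1 z
  have eu := harmonic_iterate (hu.harmonic hufin hg) n 1
  have ev := harmonic_iterate (hv.harmonic hvfin hg) n 1
  by_contra hlt
  have huv : u z < v z := (min_le_right _ _).trans_lt (not_le.1 hlt)
  have hc0 : ENNReal.ofReal R ^ n * transition μ n 1 z ≠ 0 := by
    simp [hn, hR.not_ge]
  have hctop : ENNReal.ofReal R ^ n * transition μ n 1 z ≠ ∞ :=
    ENNReal.mul_ne_top (by finiteness) (transition_ne_top μ n 1 z)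
  have := ENNReal.tsum_lt_tsum (by rw [eu]; exact hufin 1)
    (f := fun z => ENNReal.ofReal R ^ n * transition μ n 1 z * u z)
    (g := fun z => ENNReal.ofReal R ^ n * transition μ n 1 z * v z)
    (fun y => by gcongr; exact min_le_left _ _)
    ((ENNReal.mul_lt_mul_iff_right hc0 hctop).2 huv)
  rw [eu, ev, hu1] at this
  exact lt_irrefl _ this

lemma hitGreen_ne_zero (hadm : IsAdmissible μ) {r : ℝ} (hr : 0 < r) (x y : Γ) :
    hitGreen μ r x y ≠ 0 := by
  intro h
  have := hitGreen_mul_green_self μ r x y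
  rw [h, zero_mul] at this
  exact hadm.green_ne_zero hr x y this.symm

lemma tendsto_hitGreen_mul (hadm : IsAdmissible μ) {R : ℝ} (hR : 0 < R) (x y z w : Γ) :
    Filter.Tendsto (fun r => hitGreen μ r x y * hitGreen μ r z w) (nhdsWithin R (Set.Iio R))
      (nhds (hitGreen μ R x y * hitGreen μ R z w)) :=
  ENNReal.Tendsto.mul (tendsto_hitGreen μ R x y) (Or.inl (hitGreen_ne_zero hadm hR x y))
    (tendsto_hitGreen μ R z w) (Or.inl (hitGreen_ne_zero hadm hR z w))

lemma eventually_mem_Ico {R : ℝ} (hR : 1 < R) :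
    ∀ᶠ r in nhdsWithin R (Set.Iio R), r ∈ Set.Ico 1 R := by
  filter_upwards [Ioo_mem_nhdsLT hR] with r hr
  exact ⟨hr.1.le, hr.2⟩

lemma hitGreen_spectral_ne_top (hadm : IsAdmissible μ) (hR : 1 < invSpectralRadius μ) (x y : Γ) :
    hitGreen μ (invSpectralRadius μ) x y ≠ ∞ := by
  have hR0 : 0 < invSpectralRadius μ := zero_lt_one.trans hR
  have hle : hitGreen μ (invSpectralRadius μ) x y * hitGreen μ (invSpectralRadius μ) y x ≤ 1 := by
    refine le_of_tendsto (tendsto_hitGreen_mul hadm hR0 x y y x) ?_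
    filter_upwards [eventually_mem_Ico hR] with r hr
    rw [← hitGreen_self μ r x]
    exact hitGreen_mul_le μ (green_self_ne_top μ (zero_le_one.trans hr.1) hr.2) x y x
  intro h
  rw [h, ENNReal.top_mul (hitGreen_ne_zero hadm hR0 y x)] at hle
  exact ENNReal.one_ne_top (top_le_iff.1 hle)

lemma isSuperharmonic_hitGreen (hR : 1 < invSpectralRadius μ) (y : Γ) :
    IsSuperharmonic μ (ENNReal.ofReal (invSpectralRadius μ))
      (fun x => hitGreen μ (invSpectralRadius μ) x y) := by
  set R := invSpectralRadius μ with hRdef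
  have hR0 : 0 < R := zero_lt_one.trans hR
  intro x
  by_cases hxy : x = y
  · subst hxy
    -- The generating function of the first return to `x` is at most `1`, first for `r < R`.
    simp only [hitGreen_self]
    rw [← ENNReal.tsum_mul_left]
    refine ENNReal.summable.tsum_le_of_sum_le fun s => ?_
    have hlim : Filter.Tendsto
        (fun r => ∑ z ∈ s, ENNReal.ofReal r * (μ (x⁻¹ * z) * hitGreen μ r z x))
        (nhdsWithin R (Set.Iio R))
        (nhds (∑ z ∈ s, ENNReal.ofReal R * (μ (x⁻¹ * z) * hitGreen μ R z x))) := by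
      refine tendsto_finsetSum _ fun z _ => ?_
      refine ENNReal.Tendsto.mul
        ((ENNReal.continuous_ofReal.tendsto R).mono_left nhdsWithin_le_nhds)
        (Or.inl (by simpa using hR0)) ?_ (Or.inr ENNReal.ofReal_ne_top)
      exact ENNReal.Tendsto.const_mul (tendsto_hitGreen μ R z x) (Or.inr (μ.apply_ne_top _))
    refine le_of_tendsto hlim ?_
    filter_upwards [eventually_mem_Ico hR] with r hr
    have hg := green_self_ne_top μ (zero_le_one.trans hr.1) hr.2
    have hg0 : green μ r 1 1 ≠ 0 := (zero_lt_one.trans_le (one_le_green_self μ r 1)).ne'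
    refine (ENNReal.sum_le_tsum s).trans ?_
    rw [← ENNReal.mul_le_mul_iff_left hg0 hg, one_mul, ENNReal.tsum_mul_left, mul_assoc,
      ← ENNReal.tsum_mul_right]
    simp only [mul_assoc, hitGreen_mul_green_self]
    conv_rhs => rw [← green_self_eq μ r x, green_eq_delta_add]
    exact le_add_self
  · exact (hitGreen_eq_of_ne μ R hxy).ge

/-- If the Green function is infinite at the spectral radius, then `F_R(e, x) F_R(x, e) = 1`. -/
lemma hitGreen_mul_hitGreen_eq_one (hadm : IsAdmissible μ) (hR : 1 < invSpectralRadius μ)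
    (hg : green μ (invSpectralRadius μ) 1 1 = ∞) (x : Γ) :
    hitGreen μ (invSpectralRadius μ) 1 x * hitGreen μ (invSpectralRadius μ) x 1 = 1 := by
  set R := invSpectralRadius μ with hRdef
  have hR0 : 0 < R := zero_lt_one.trans hR
  have hfin := hitGreen_spectral_ne_top hadm hR
  have hw := isSuperharmonic_hitGreen hR x
  have hv : IsSuperharmonic μ (ENNReal.ofReal R)
      (fun z => hitGreen μ R 1 x * hitGreen μ R z 1) := by
    intro z
    have := isSuperharmonic_hitGreen hR (1 : Γ) z
    calc _ = hitGreen μ R 1 x *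
          (ENNReal.ofReal R * ∑' w, μ (z⁻¹ * w) * hitGreen μ R w 1) := by
          simp only [← ENNReal.tsum_mul_left]
          refine tsum_congr fun w => ?_
          ring
      _ ≤ _ := mul_le_mul' le_rfl this
  have hvfin : ∀ z, hitGreen μ R 1 x * hitGreen μ R z 1 ≠ ∞ :=
    fun z => ENNReal.mul_ne_top (hfin _ _) (hfin _ _)
  have h1 : hitGreen μ R 1 x * hitGreen μ R 1 1 = hitGreen μ R 1 x := by
    rw [hitGreen_self, mul_one]
  refine le_antisymm ?_ ?_
  · have := hv.le_of_eq_one hadm hR0 hg hw hvfin h1 x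
    rwa [hitGreen_self] at this
  · have := hw.le_of_eq_one hadm hR0 hg hv (fun z => hfin z x) h1.symm x
    simpa only [hitGreen_self] using this

end Recurrence

section Transience

variable {Γ : Type*} [Group Γ] {μ : PMF Γ} {d : Γ → Γ → ℕ} {k : ℕ}

lemma firstHit_mul_left (μ : PMF Γ) (g y : Γ) (n : ℕ) (x : Γ) :
    firstHit μ (g * y) n (g * x) = firstHit μ y n x := by
  induction n generalizing x with
  | zero => by_cases h : x = y <;> simp [firstHit, h]
  | succ n ih =>
    by_cases h : x = y
    · rw [h, firstHit_succ_self, firstHit_succ_self]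
    · rw [firstHit_succ_of_ne μ h, firstHit_succ_of_ne μ (by simpa using h),
        ← (Equiv.mulLeft g).tsum_eq]
      refine tsum_congr fun z => ?_
      simp only [Equiv.coe_mulLeft, ih]
      congr 2
      group

lemma hitGreen_mul_left (μ : PMF Γ) (r : ℝ) (g x y : Γ) :
    hitGreen μ r (g * x) (g * y) = hitGreen μ r x y := by
  simp only [hitGreen, firstHit_mul_left]

lemma hitGreen_le_green (μ : PMF Γ) (r : ℝ) (x y : Γ) : hitGreen μ r x y ≤ green μ r x y := by
  unfold hitGreen green
  gcongr with n
  exact firstHit_le_transition μ y n x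

lemma monotone_hitGreen (μ : PMF Γ) (x y : Γ) : Monotone fun r => hitGreen μ r x y :=
  monotone_tsum_ofReal_pow _

/-- The first-visit version `F_r(e, x) F_r(x, e)` of `H_r(e, x)`. -/
noncomputable def hitH (μ : PMF Γ) (r : ℝ) (x : Γ) : ℝ≥0∞ := hitGreen μ r 1 x * hitGreen μ r x 1

lemma hitH_mul_le {r : ℝ} (hg : green μ r 1 1 ≠ ∞) (x y : Γ) :
    hitH μ r x * hitH μ r y ≤ hitH μ r (x * y) := by
  have e1 := hitGreen_mul_le μ hg 1 x (x * y)
  have e2 := hitGreen_mul_le μ hg (x * y) x 1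
  have e3 : hitGreen μ r x (x * y) = hitGreen μ r 1 y := by
    simpa using hitGreen_mul_left μ r x 1 y
  have e4 : hitGreen μ r (x * y) x = hitGreen μ r y 1 := by
    simpa using hitGreen_mul_left μ r x y 1
  rw [e3] at e1
  rw [e4] at e2
  calc hitH μ r x * hitH μ r y = (hitGreen μ r 1 x * hitGreen μ r 1 y) *
        (hitGreen μ r y 1 * hitGreen μ r x 1) := by simp only [hitH]; ring
    _ ≤ _ := mul_le_mul' e1 e2

lemma IsHyperbolicMetric.card_filter_near_le (hd : IsHyperbolicMetric d k) (P : Finset Γ) (c : ℕ)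
    (p : Γ → Prop) [DecidablePred p] (h : ∀ x y, p x → p y → d x y ≤ c) :
    (P.filter p).card ≤ (hd.ball c).card := by
  rcases (P.filter p).eq_empty_or_nonempty with h0 | ⟨x, hx⟩
  · simp [h0]
  · refine Finset.card_le_card_of_injOn (fun y => x⁻¹ * y) (fun y hy => ?_)
      (mul_right_injective _).injOn
    rw [Finset.mem_coe, Finset.mem_filter] at hy
    rw [Finset.mem_filter] at hx
    rw [Finset.mem_coe, hd.mem_ball, hd.dist_one_inv_mul]
    exact h x y hx.2 hy.2

/-- Supermultiplicativity along sequences `x, a, y` without backtracking bounds the sums over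
spheres: `∑ F(x) · ∑ F(y)`, over `x` in a sphere and all `y`, is at most a constant times
`∑ F(z)` over all `z`, because `z = x a y` and the radius determine `x` up to finitely many
choices. -/
lemma exists_sum_sphere_le (hadm : IsAdmissible μ) (hd : IsHyperbolicMetric d k) {B C : ℕ}
    (hturn : ∀ u v x, ∃ a, d 1 a ≤ B ∧ d 1 u + d 1 (a * x) ≤ d u (a * x) + C ∧
      d 1 v + d 1 (a * x) ≤ d v (a * x) + C) :
    ∃ M : ℝ≥0∞, M ≠ ∞ ∧ ∀ r ∈ Set.Ico 1 (invSpectralRadius μ), ∀ (m : ℕ) (P : Finset Γ),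
      (∀ x ∈ P, d 1 x = m) → ∑ x ∈ P, hitH μ r x ≤ M := by
  classical
  have h0 : ∀ {r : ℝ}, 0 < r → ∀ x, hitH μ r x ≠ 0 := fun hr x =>
    mul_ne_zero (hitGreen_ne_zero hadm hr _ _) (hitGreen_ne_zero hadm hr _ _)
  let K := ∑ a ∈ hd.ball B, (hitH μ 1 a)⁻¹
  have hK : K ≠ ∞ := ENNReal.sum_ne_top.2 fun a _ => ENNReal.inv_ne_top.2 (h0 one_pos a)
  refine ⟨K * ((hd.ball B).card * (hd.ball (C + k)).card), by finiteness, ?_⟩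
  intro r hr m P hP
  have hr0 : 0 < r := zero_lt_one.trans_le hr.1
  have hg := green_self_ne_top μ hr0.le hr.2
  have step : ∀ x y, hitH μ r x * hitH μ r y ≤ K * ∑ a ∈ hd.ball B,
      if d 1 x + d x (x * a * y) ≤ d 1 (x * a * y) + C then hitH μ r (x * a * y) else 0 := by
    intro x y
    obtain ⟨a, ha, hxa, -⟩ := hturn x⁻¹ x⁻¹ y
    have haB : a ∈ hd.ball B := hd.mem_ball.2 ha
    have e1 : d 1 x⁻¹ = d 1 x := by rw [← hd.left_inv x, mul_one, mul_inv_cancel, hd.comm]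
    have e2 : d 1 (a * y) = d x (x * a * y) := by
      rw [← hd.left_inv x, mul_one, mul_assoc]
    have e3 : d x⁻¹ (a * y) = d 1 (x * a * y) := by
      rw [← hd.left_inv x, mul_inv_cancel, mul_assoc]
    rw [e1, e2, e3] at hxa
    have hKa : 1 ≤ K * hitH μ r a := by
      have h1 : hitH μ 1 a ≤ hitH μ r a :=
        mul_le_mul' (monotone_hitGreen μ _ _ hr.1) (monotone_hitGreen μ _ _ hr.1)
      have hfin : hitH μ 1 a ≠ ∞ := by
        refine ne_top_of_le_ne_top ?_ h1
        refine ne_top_of_le_ne_top (eta_ne_top μ hr0.le hr.2) (le_trans ?_ (ENNReal.le_tsum a))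
        exact mul_le_mul' (hitGreen_le_green μ r 1 a) (hitGreen_le_green μ r a 1)
      calc 1 = (hitH μ 1 a)⁻¹ * hitH μ 1 a := (ENNReal.inv_mul_cancel (h0 one_pos a) hfin).symm
        _ ≤ K * hitH μ r a := mul_le_mul' (Finset.single_le_sum (f := fun a => (hitH μ 1 a)⁻¹)
            (fun _ _ => bot_le) haB) h1
    calc hitH μ r x * hitH μ r y ≤ (K * hitH μ r a) * (hitH μ r x * hitH μ r y) :=
          le_mul_of_one_le_left bot_le hKa
      _ = K * (hitH μ r x * hitH μ r a * hitH μ r y) := by ring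
      _ ≤ K * hitH μ r (x * a * y) := by
          gcongr
          exact (mul_le_mul_left (hitH_mul_le hg x a) _).trans (hitH_mul_le hg (x * a) y)
      _ ≤ _ := by
          gcongr
          refine le_trans ?_ (Finset.single_le_sum (f := fun a =>
            if d 1 x + d x (x * a * y) ≤ d 1 (x * a * y) + C then hitH μ r (x * a * y) else 0)
            (fun _ _ => bot_le) haB)
          simp only [hxa, if_true, le_refl]
  -- `y` ranges over the whole group, so that the total sum can be cancelled in the end.
  let T := ∑' z, hitH μ r z
  have hT0 : T ≠ 0 := fun h => h0 hr0 1 (ENNReal.tsum_eq_zero.1 h 1)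
  have hT : T ≠ ∞ := by
    refine ne_top_of_le_ne_top (eta_ne_top μ hr0.le hr.2) (ENNReal.tsum_le_tsum fun z => ?_)
    exact mul_le_mul' (hitGreen_le_green μ r 1 z) (hitGreen_le_green μ r z 1)
  rw [← ENNReal.mul_le_mul_iff_left hT0 hT]
  calc (∑ x ∈ P, hitH μ r x) * T = ∑ x ∈ P, ∑' y, hitH μ r x * hitH μ r y := by
        rw [Finset.sum_mul]
        simp only [T, ENNReal.tsum_mul_left]
    _ ≤ ∑ x ∈ P, ∑' y, K * ∑ a ∈ hd.ball B,
        if d 1 x + d x (x * a * y) ≤ d 1 (x * a * y) + C then hitH μ r (x * a * y) else 0 := 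
        Finset.sum_le_sum fun x _ => ENNReal.tsum_le_tsum fun y => step x y
    _ = K * ∑ a ∈ hd.ball B, ∑ x ∈ P, ∑' z,
        if d 1 x + d x z ≤ d 1 z + C then hitH μ r z else 0 := by
        rw [Finset.sum_comm, Finset.mul_sum]
        refine Finset.sum_congr rfl fun x _ => ?_
        rw [ENNReal.tsum_mul_left, Summable.tsum_finsetSum fun _ _ => ENNReal.summable]
        congr 1
        refine Finset.sum_congr rfl fun a _ => ?_
        exact (Equiv.mulLeft (x * a)).tsum_eq
          (fun z => if d 1 x + d x z ≤ d 1 z + C then hitH μ r z else 0)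
    _ ≤ K * ∑ a ∈ hd.ball B, (hd.ball (C + k)).card * T := by
        gcongr with a _
        rw [← Summable.tsum_finsetSum fun _ _ => ENNReal.summable, ← ENNReal.tsum_mul_left]
        refine ENNReal.tsum_le_tsum fun z => ?_
        rw [← Finset.sum_filter, Finset.sum_const, nsmul_eq_mul]
        refine mul_le_mul' (Nat.cast_le.2 ?_) le_rfl
        rw [← Finset.filter_true_of_mem hP, Finset.filter_filter]
        refine hd.card_filter_near_le P (C + k) _ fun x y hx hy => ?_
        have := hd.four_point x y 1 z
        have := hd.comm x 1
        have := hd.comm y 1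
        omega
    _ = K * ((hd.ball B).card * (hd.ball (C + k)).card) * T := by
        rw [Finset.sum_const, nsmul_eq_mul]; ring

/-- The Green function is finite at the spectral radius. Otherwise `F_R(e, x) F_R(x, e) = 1` for all
`x`, and the bound for the sums over spheres bounds the cardinalities of the spheres. -/
lemma green_spectral_ne_top (hadm : IsAdmissible μ) (hd : IsHyperbolicMetric d k) {B C : ℕ}
    (hturn : ∀ u v x, ∃ a, d 1 a ≤ B ∧ d 1 u + d 1 (a * x) ≤ d u (a * x) + C ∧
      d 1 v + d 1 (a * x) ≤ d v (a * x) + C)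
    (hgrow : ∀ c, ∃ B, c * (B + 1) < (hd.ball B).card) (hR : 1 < invSpectralRadius μ) :
    green μ (invSpectralRadius μ) 1 1 ≠ ∞ := by
  classical
  intro hg
  obtain ⟨M, hM, hsum⟩ := exists_sum_sphere_le hadm hd hturn
  obtain ⟨c, hc⟩ := ENNReal.exists_nat_gt hM
  have hcard : ∀ m (P : Finset Γ), (∀ x ∈ P, d 1 x = m) → P.card ≤ c := by
    intro m P hP
    have hlim : Filter.Tendsto (fun r => ∑ x ∈ P, hitH μ r x)
        (nhdsWithin (invSpectralRadius μ) (Set.Iio (invSpectralRadius μ)))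
        (nhds (∑ x ∈ P, hitH μ (invSpectralRadius μ) x)) :=
      tendsto_finsetSum _ fun x _ => tendsto_hitGreen_mul hadm (zero_lt_one.trans hR) _ _ _ _
    have hle : ∑ x ∈ P, hitH μ (invSpectralRadius μ) x ≤ M := by
      refine le_of_tendsto hlim ?_
      filter_upwards [eventually_mem_Ico hR] with r hr
      exact hsum r hr m P hP
    have h1 : ∀ x, hitH μ (invSpectralRadius μ) x = 1 := hitGreen_mul_hitGreen_eq_one hadm hR hg
    simp only [h1, Finset.sum_const, nsmul_eq_mul, mul_one] at hle
    exact_mod_cast (hle.trans_lt hc).le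
  obtain ⟨n, hn⟩ := hgrow c
  refine hn.not_ge ?_
  have hmaps : ∀ x ∈ hd.ball n, d 1 x ∈ Finset.range (n + 1) := fun x hx => by
    rw [hd.mem_ball] at hx
    rw [Finset.mem_range]
    omega
  refine (Finset.card_le_mul_card_image_of_maps_to hmaps c fun m _ => ?_).trans ?_
  · exact hcard m _ fun x hx => (Finset.mem_filter.1 hx).2
  · rw [Finset.card_range]

end Transience

/-! ### Sums over triangles and the cube of `η` -/

section Triangles

variable {Γ : Type*} [Group Γ] {μ : PMF Γ} {d : Γ → Γ → ℕ} {k : ℕ}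

/-- The product of the Green functions along the sides of the triangle `e`, `y`, `x`. -/
noncomputable def greenTriangle (μ : PMF Γ) (r : ℝ) (x y : Γ) : ℝ≥0∞ :=
  green μ r 1 y * green μ r y x * green μ r x 1

lemma tsum_greenH (μ : PMF Γ) (r : ℝ) (w : Γ) : ∑' x, greenH μ r w x = eta μ r := by
  rw [eta, ← (Equiv.mulLeft w).tsum_eq]
  refine tsum_congr fun x => ?_
  simpa using greenH_mul_left μ r w 1 x

lemma UniformAncona.between {S : Set Γ} (hG : (SimpleGraph.mulCayley S).Connected)
    (hanc : UniformAncona S μ) (D : ℕ) :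
    ∃ C : ℝ≥0∞, C ≠ ∞ ∧ ∀ x z y w, wordDist S x w + wordDist S w z = wordDist S x z →
      wordDist S y w ≤ D → ∀ r ∈ Set.Icc 1 (invSpectralRadius μ),
        green μ r x z ≤ C * (green μ r x y * green μ r y z) := by
  obtain ⟨C, -, hC⟩ := hanc D
  refine ⟨ENNReal.ofReal C, ENNReal.ofReal_ne_top, fun x z y w hw hy => ?_⟩
  obtain ⟨p, hp, hwp⟩ := exists_isGeodesic_mem_support hG hw
  exact hC x z p hp y ⟨w, hwp, hy⟩

/-- Ancona inequalities at the center `w` of the triangle `e`, `y`, `x` bound the product along its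
sides by `H_r(e, w) H_r(w, y) H_r(w, x)`. -/
lemma exists_tsum_greenTriangle_le {S : Set Γ} (hG : (SimpleGraph.mulCayley S).Connected)
    (hhyp : IsHyperbolic S) (hanc : UniformAncona S μ) :
    ∃ c : ℝ≥0∞, c ≠ ∞ ∧ ∀ r ∈ Set.Icc 1 (invSpectralRadius μ),
      ∑' (x : Γ) (y : Γ), greenTriangle μ r x y ≤ c * eta μ r ^ 3 := by
  obtain ⟨D, hD⟩ := exists_center hG hhyp
  obtain ⟨C, hC, hgreen⟩ := hanc.between hG D
  refine ⟨C ^ 3, by finiteness, fun r hr => ?_⟩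
  have comm : ∀ a b : Γ, wordDist S a b = wordDist S b a := fun a b => SimpleGraph.dist_comm
  have step : ∀ x y, greenTriangle μ r x y ≤
      C ^ 3 * ∑' w, greenH μ r 1 w * greenH μ r w y * greenH μ r w x := by
    intro x y
    obtain ⟨w, hw, ⟨v, hv, hwv⟩, ⟨v', hv', hwv'⟩⟩ := hD 1 y x
    have h1 := hgreen 1 y w w hw (by simp [wordDist]) r hr
    have h2 := hgreen y x w v hv hwv r hr
    have h3 := hgreen x 1 w v' (by rw [comm x v', comm v' 1, comm x 1, add_comm]; exact hv')
      hwv' r hr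
    calc greenTriangle μ r x y ≤ (C * (green μ r 1 w * green μ r w y)) *
          (C * (green μ r y w * green μ r w x)) * (C * (green μ r x w * green μ r w 1)) :=
          mul_le_mul' (mul_le_mul' h1 h2) h3
      _ = C ^ 3 * (greenH μ r 1 w * greenH μ r w y * greenH μ r w x) := by
          simp only [greenH]; ring
      _ ≤ _ := by
          gcongr
          exact ENNReal.le_tsum (f := fun w => greenH μ r 1 w * greenH μ r w y * greenH μ r w x) w
  calc ∑' (x : Γ) (y : Γ), greenTriangle μ r x y
      ≤ ∑' (x : Γ) (y : Γ), C ^ 3 * ∑' w, greenH μ r 1 w * greenH μ r w y * greenH μ r w x :=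
        ENNReal.tsum_le_tsum fun x => ENNReal.tsum_le_tsum fun y => step x y
    _ = C ^ 3 * ∑' (w : Γ) (x : Γ) (y : Γ),
          greenH μ r 1 w * greenH μ r w y * greenH μ r w x := by
        simp only [ENNReal.tsum_mul_left]
        congr 1
        exact (tsum_congr fun x => ENNReal.tsum_comm).trans ENNReal.tsum_comm
    _ = C ^ 3 * eta μ r ^ 3 := by
        congr 1
        simp only [ENNReal.tsum_mul_right, ENNReal.tsum_mul_left, tsum_greenH]
        ring

/-- Moving the end point by a fixed element costs at most a factor independent of `r ≥ 1`. -/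
lemma IsAdmissible.exists_greenH_le (hadm : IsAdmissible μ) (a : Γ) :
    ∃ κ : ℝ≥0∞, κ ≠ ∞ ∧ ∀ r : ℝ, 1 ≤ r → ∀ x, greenH μ r 1 x ≤ κ * greenH μ r 1 (a * x) := by
  obtain ⟨m, hm⟩ := hadm.exists_transition_ne_zero 1 a
  obtain ⟨n, hn⟩ := hadm.exists_transition_ne_zero a 1
  set p := transition μ m 1 a * transition μ n a 1 with hp
  have hp0 : p ≠ 0 := mul_ne_zero hm hn
  have hpt : p ≠ ∞ := ENNReal.mul_ne_top (transition_ne_top μ _ _ _) (transition_ne_top μ _ _ _)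
  refine ⟨p⁻¹, ENNReal.inv_ne_top.2 hp0, fun r hr x => ?_⟩
  have ht : 1 ≤ ENNReal.ofReal r := by simpa using hr
  have e1 := transition_mul_green_le μ r m 1 a (a * x)
  have e2 := green_mul_transition_le μ r n (a * x) a 1
  have e3 : greenH μ r a (a * x) = greenH μ r 1 x := by simpa using greenH_mul_left μ r a 1 x
  have key : p * greenH μ r 1 x ≤ greenH μ r 1 (a * x) := by
    rw [← e3]
    calc p * greenH μ r a (a * x)
        ≤ (ENNReal.ofReal r ^ m * ENNReal.ofReal r ^ n) * (p * greenH μ r a (a * x)) :=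
          le_mul_of_one_le_left bot_le
            (one_le_mul (one_le_pow_of_one_le' ht m) (one_le_pow_of_one_le' ht n))
      _ = (ENNReal.ofReal r ^ m * transition μ m 1 a * green μ r a (a * x)) *
          (green μ r (a * x) a * (ENNReal.ofReal r ^ n * transition μ n a 1)) := by
          simp only [greenH, hp]; ring
      _ ≤ _ := mul_le_mul' e1 e2
  calc greenH μ r 1 x = p⁻¹ * (p * greenH μ r 1 x) := by
        rw [← mul_assoc, ENNReal.inv_mul_cancel hp0 hpt, one_mul]
    _ ≤ _ := by gcongr

/-- `w` is, up to `C`, on geodesics between any two of the points `e`, `x`, `y`. -/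
def IsQuasiMedian (d : Γ → Γ → ℕ) (C : ℕ) (x y w : Γ) : Prop :=
  d 1 w + d w x ≤ d 1 x + C ∧ d 1 w + d w y ≤ d 1 y + C ∧ d w x + d w y ≤ d x y + C

lemma IsHyperbolicMetric.dist_quasiMedian_le (hd : IsHyperbolicMetric d k) {C : ℕ} {x y w w' : Γ}
    (h : IsQuasiMedian d C x y w) (h' : IsQuasiMedian d C x y w') : d w w' ≤ C + k := by
  obtain ⟨h1, h2, h3⟩ := h
  obtain ⟨h1', h2', h3'⟩ := h'
  have f1 := hd.four_point w w' 1 x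
  have f2 := hd.four_point w w' 1 y
  have f3 := hd.four_point w w' x y
  have c1 := hd.comm w 1
  have c2 := hd.comm w' 1
  omega

lemma IsHyperbolicMetric.tsum_quasiMedian_le (hd : IsHyperbolicMetric d k) (C : ℕ) (x y : Γ)
    (τ : ℝ≥0∞) [DecidablePred (IsQuasiMedian d C x y)] :
    ∑' w, (if IsQuasiMedian d C x y w then τ else 0) ≤ (hd.ball (C + k)).card * τ := by
  refine ENNReal.summable.tsum_le_of_sum_le fun P => ?_
  rw [← Finset.sum_filter, Finset.sum_const, nsmul_eq_mul]
  refine mul_le_mul' (Nat.cast_le.2 ?_) le_rfl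
  exact hd.card_filter_near_le P (C + k) _ fun w w' h h' => hd.dist_quasiMedian_le h h'

/-- Given `w`, `x` and `y`, turning `x` and `y` by elements `a` and `b` of a fixed ball makes `w` a
quasi-median of `e`, `w a x` and `w b y`; such a `w` is determined by these points up to finitely
many choices, and the product of `H_r` along the three branches is at most a constant times
the product along the sides, because the Green function is bounded on the diagonal. -/
lemma exists_eta_cube_le (hadm : IsAdmissible μ) (hd : IsHyperbolicMetric d k) {B C : ℕ}
    (hturn : ∀ u v x, ∃ a, d 1 a ≤ B ∧ d 1 u + d 1 (a * x) ≤ d u (a * x) + C ∧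
      d 1 v + d 1 (a * x) ≤ d v (a * x) + C)
    (hg : green μ (invSpectralRadius μ) 1 1 ≠ ∞) :
    ∃ c : ℝ≥0∞, c ≠ ∞ ∧ ∀ r ∈ Set.Icc 1 (invSpectralRadius μ),
      eta μ r ^ 3 ≤ c * ∑' (x : Γ) (y : Γ), greenTriangle μ r x y := by
  classical
  choose κ hκ hκle using hadm.exists_greenH_le
  let K := ∑ a ∈ hd.ball B, κ a
  have hK : K ≠ ∞ := ENNReal.sum_ne_top.2 fun a _ => hκ a
  let g := green μ (invSpectralRadius μ) 1 1
  let N := (hd.ball B).card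
  let V := (hd.ball (C + k)).card
  refine ⟨K ^ 2 * g ^ 3 * (N * (N * V)), by finiteness, fun r hr => ?_⟩
  have hgr : ∀ x y z, green μ r x y * green μ r y z ≤ g * green μ r x z := fun x y z =>
    (green_mul_green_le μ r x y z).trans (mul_le_mul' (monotone_green μ 1 1 hr.2) le_rfl)
  have step : ∀ w x y, greenH μ r 1 w * greenH μ r 1 x * greenH μ r 1 y ≤ K ^ 2 * g ^ 3 *
      ∑ a ∈ hd.ball B, ∑ b ∈ hd.ball B,
        if IsQuasiMedian d C (w * a * x) (w * b * y) w
          then greenTriangle μ r (w * a * x) (w * b * y) else 0 := by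
    intro w x y
    obtain ⟨a, ha, hwa, -⟩ := hturn w⁻¹ w⁻¹ x
    obtain ⟨b, hb, hwb, hab⟩ := hturn w⁻¹ (a * x) y
    have hw : ∀ z, d w⁻¹ z = d 1 (w * z) := fun z => by
      rw [← hd.left_inv w, mul_inv_cancel]
    have hw' : ∀ z, d 1 z = d w (w * z) := fun z => by rw [← hd.left_inv w, mul_one]
    have hw1 : d 1 w⁻¹ = d 1 w := by rw [hd.comm, hw, mul_one]
    have hqm : IsQuasiMedian d C (w * a * x) (w * b * y) w := by
      rw [hw1, hw, hw' (a * x)] at hwa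
      rw [hw1, hw, hw' (b * y)] at hwb
      rw [hw', hw' (b * y), ← hd.left_inv w (a * x)] at hab
      simp only [IsQuasiMedian, mul_assoc]
      exact ⟨hwa, hwb, hab⟩
    set X := w * a * x with hX
    set Y := w * b * y with hY
    have hHX : greenH μ r 1 x ≤ K * greenH μ r w X := by
      have e : greenH μ r w X = greenH μ r 1 (a * x) := by
        simpa [hX, mul_assoc] using greenH_mul_left μ r w 1 (a * x)
      rw [e]
      exact (hκle a r hr.1 x).trans (mul_le_mul' (Finset.single_le_sum (f := κ)
        (fun _ _ => bot_le) (hd.mem_ball.2 ha)) le_rfl)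
    have hHY : greenH μ r 1 y ≤ K * greenH μ r w Y := by
      have e : greenH μ r w Y = greenH μ r 1 (b * y) := by
        simpa [hY, mul_assoc] using greenH_mul_left μ r w 1 (b * y)
      rw [e]
      exact (hκle b r hr.1 y).trans (mul_le_mul' (Finset.single_le_sum (f := κ)
        (fun _ _ => bot_le) (hd.mem_ball.2 hb)) le_rfl)
    calc greenH μ r 1 w * greenH μ r 1 x * greenH μ r 1 y
        ≤ greenH μ r 1 w * (K * greenH μ r w X) * (K * greenH μ r w Y) := by gcongr
      _ = K ^ 2 * ((green μ r 1 w * green μ r w Y) * (green μ r Y w * green μ r w X) *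
          (green μ r X w * green μ r w 1)) := by simp only [greenH]; ring
      _ ≤ K ^ 2 * ((g * green μ r 1 Y) * (g * green μ r Y X) * (g * green μ r X 1)) :=
          mul_le_mul' le_rfl (mul_le_mul' (mul_le_mul' (hgr _ _ _) (hgr _ _ _)) (hgr _ _ _))
      _ = K ^ 2 * g ^ 3 * greenTriangle μ r X Y := by simp only [greenTriangle]; ring
      _ ≤ _ := by
          refine mul_le_mul' le_rfl ?_
          refine le_trans ?_ (Finset.single_le_sum (fun _ _ => bot_le) (hd.mem_ball.2 ha))
          refine le_trans ?_ (Finset.single_le_sum (fun _ _ => bot_le) (hd.mem_ball.2 hb))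
          rw [if_pos hqm]
  calc eta μ r ^ 3 = ∑' (w : Γ) (x : Γ) (y : Γ),
        greenH μ r 1 w * greenH μ r 1 x * greenH μ r 1 y := by
        simp only [ENNReal.tsum_mul_left, ENNReal.tsum_mul_right]
        rw [← eta]
        ring
    _ ≤ ∑' (w : Γ) (x : Γ) (y : Γ), K ^ 2 * g ^ 3 * ∑ a ∈ hd.ball B, ∑ b ∈ hd.ball B,
        (if IsQuasiMedian d C (w * a * x) (w * b * y) w
          then greenTriangle μ r (w * a * x) (w * b * y) else 0) :=
        ENNReal.tsum_le_tsum fun w => ENNReal.tsum_le_tsum fun x => ENNReal.tsum_le_tsum fun y =>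
          step w x y
    _ = K ^ 2 * g ^ 3 * ∑ a ∈ hd.ball B, ∑ b ∈ hd.ball B, ∑' (w : Γ) (x : Γ) (y : Γ),
        (if IsQuasiMedian d C (w * a * x) (w * b * y) w
          then greenTriangle μ r (w * a * x) (w * b * y) else 0) := by
        simp only [ENNReal.tsum_mul_left, Summable.tsum_finsetSum fun _ _ => ENNReal.summable]
    _ = K ^ 2 * g ^ 3 * ∑ a ∈ hd.ball B, ∑ b ∈ hd.ball B, ∑' (w : Γ) (X : Γ) (Y : Γ),
        (if IsQuasiMedian d C X Y w then greenTriangle μ r X Y else 0) := by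
        congr 1
        refine Finset.sum_congr rfl fun a _ => Finset.sum_congr rfl fun b _ =>
          tsum_congr fun w => ?_
        refine Eq.trans (tsum_congr fun x => ?_) ((Equiv.mulLeft (w * a)).tsum_eq fun X =>
          ∑' Y, if IsQuasiMedian d C X Y w then greenTriangle μ r X Y else 0)
        exact (Equiv.mulLeft (w * b)).tsum_eq fun Y =>
          if IsQuasiMedian d C (w * a * x) Y w then greenTriangle μ r (w * a * x) Y else 0
    _ = K ^ 2 * g ^ 3 * (N * (N * ∑' (X : Γ) (Y : Γ) (w : Γ),
        (if IsQuasiMedian d C X Y w then greenTriangle μ r X Y else 0))) := by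
        rw [Finset.sum_const, Finset.sum_const, nsmul_eq_mul, nsmul_eq_mul]
        congr 3
        exact ENNReal.tsum_comm.trans (tsum_congr fun X => ENNReal.tsum_comm)
    _ ≤ K ^ 2 * g ^ 3 * (N * (N * ∑' (X : Γ) (Y : Γ), V * greenTriangle μ r X Y)) := by
        refine mul_le_mul' le_rfl (mul_le_mul' le_rfl (mul_le_mul' le_rfl ?_))
        exact ENNReal.tsum_le_tsum fun X => ENNReal.tsum_le_tsum fun Y =>
          hd.tsum_quasiMedian_le C X Y _
    _ = K ^ 2 * g ^ 3 * (N * (N * V)) * ∑' (x : Γ) (y : Γ), greenTriangle μ r x y := by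
        simp only [ENNReal.tsum_mul_left]
        ring

end Triangles

/-! ### The differential inequality -/

section DifferentialInequality

open Set Filter Topology

/-- If `E = r² e` satisfies `E' ≍ e³`, then `E⁻²` has a derivative bounded above and below by
negative constants, and integrating up to `R` gives the asymptotics of `e`. -/
lemma exists_inv_sqrt_bounds {R : ℝ} (hR : 1 < R) {e s : ℝ → ℝ} (he : ∀ r ∈ Ico 1 R, 0 < e r)
    (hderiv : ∀ r ∈ Ico 1 R, HasDerivAt (fun x => x ^ 2 * e x) (r * s r) r) {K : ℝ} (hK : 0 < K)
    (h1 : ∀ r ∈ Ico 1 R, s r ≤ K * e r ^ 3) (h2 : ∀ r ∈ Ico 1 R, e r ^ 3 ≤ K * s r) {a : ℝ}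
    (hlim : Tendsto (fun r => (e r)⁻¹) (𝓝[<] R) (𝓝 a)) :
    ∃ C : ℝ, 0 < C ∧ ∀ r ∈ Ico 1 R,
      C⁻¹ / √(((R ^ 2)⁻¹ * a) ^ 2 + (R - r)) ≤ e r ∧
        e r ≤ C / √(((R ^ 2)⁻¹ * a) ^ 2 + (R - r)) := by
  have hR0 : 0 < R := zero_lt_one.trans hR
  set A := ((R ^ 2)⁻¹ * a) ^ 2 with hA
  let g : ℝ → ℝ := fun r => ((r ^ 2 * e r) ^ 2)⁻¹
  have hE : ∀ r ∈ Ico 1 R, 0 < r ^ 2 * e r := fun r hr => by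
    have := he r hr
    have : 0 < r := zero_lt_one.trans_le hr.1
    positivity
  have hg : ∀ r ∈ Ico 1 R, HasDerivAt g (-(2 * s r / (r ^ 5 * e r ^ 3))) r := by
    intro r hr
    have h0 := he r hr
    have hr0 : 0 < r := zero_lt_one.trans_le hr.1
    have hp := hE r hr
    refine (((hderiv r hr).fun_pow 2).fun_inv (by positivity)).congr_deriv ?_
    field_simp
    norm_num
    ring
  have hcont : ContinuousOn g (Ico 1 R) := fun r hr => (hg r hr).continuousAt.continuousWithinAt
  have hdiff : DifferentiableOn ℝ g (interior (Ico 1 R)) := fun r hr =>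
    (hg r (interior_subset hr)).differentiableAt.differentiableWithinAt
  let c₁ : ℝ := 2 / (K * R ^ 5)
  let c₂ : ℝ := 2 * K
  have hupper := (convex_Ico 1 R).image_sub_le_mul_sub_of_deriv_le hcont hdiff (C := -c₁) (by
    intro r hr'
    have hr := interior_subset hr'
    rw [(hg r hr).deriv, neg_le_neg_iff]
    have h0 := he r hr
    have hr0 : 0 < r := zero_lt_one.trans_le hr.1
    have hrR : r ^ 5 ≤ R ^ 5 := pow_le_pow_left₀ hr0.le hr.2.le 5
    rw [div_le_div_iff₀ (by positivity) (by positivity)]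
    have h3 := h2 r hr
    calc 2 * (r ^ 5 * e r ^ 3) ≤ 2 * (R ^ 5 * (K * s r)) := by gcongr
      _ = 2 * s r * (K * R ^ 5) := by ring)
  have hlower := (convex_Ico 1 R).mul_sub_le_image_sub_of_le_deriv hcont hdiff (C := -c₂) (by
    intro r hr'
    have hr := interior_subset hr'
    rw [(hg r hr).deriv, neg_le_neg_iff]
    have h0 := he r hr
    have hr0 : 0 < r := zero_lt_one.trans_le hr.1
    have hr5 : 1 ≤ r ^ 5 := one_le_pow₀ hr.1
    rw [div_le_iff₀ (by positivity)]
    have h3 := h1 r hr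
    calc 2 * s r ≤ 2 * (K * e r ^ 3) := by gcongr
      _ = c₂ * (1 * e r ^ 3) := by simp only [c₂]; ring
      _ ≤ c₂ * (r ^ 5 * e r ^ 3) := by gcongr)
  have hglim : Tendsto g (𝓝[<] R) (𝓝 A) := by
    have hid : Tendsto (fun r : ℝ => (r ^ 2)⁻¹) (𝓝[<] R) (𝓝 (R ^ 2)⁻¹) :=
      (((continuous_pow 2).tendsto R).inv₀ (by positivity)).mono_left nhdsWithin_le_nhds
    refine ((hid.mul hlim).pow 2).congr fun r => ?_
    rw [← mul_inv, inv_pow]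
  have hIco : ∀ r ∈ Ico 1 R, ∀ᶠ t in 𝓝[<] R, t ∈ Ico 1 R ∧ r ≤ t := by
    intro r hr
    filter_upwards [Ioo_mem_nhdsLT hr.2] with t ht
    exact ⟨⟨hr.1.trans ht.1.le, ht.2⟩, ht.1.le⟩
  have hid : ∀ r, Tendsto (fun t : ℝ => t - r) (𝓝[<] R) (𝓝 (R - r)) := fun r =>
    ((continuous_sub_right r).tendsto R).mono_left nhdsWithin_le_nhds
  have hg1 : ∀ r ∈ Ico 1 R, A + c₁ * (R - r) ≤ g r := by
    intro r hr
    have hle : A - g r ≤ -c₁ * (R - r) := by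
      refine le_of_tendsto_of_tendsto (hglim.sub_const _) ((hid r).const_mul _) ?_
      filter_upwards [hIco r hr] with t ht
      exact hupper r hr t ht.1 ht.2
    linarith
  have hg2 : ∀ r ∈ Ico 1 R, g r ≤ A + c₂ * (R - r) := by
    intro r hr
    have hle : -c₂ * (R - r) ≤ A - g r := by
      refine le_of_tendsto_of_tendsto ((hid r).const_mul _) (hglim.sub_const _) ?_
      filter_upwards [hIco r hr] with t ht
      exact hlower r hr t ht.1 ht.2
    linarith
  have hc₁ : 0 < c₁ := by positivity
  have hc₂ : 0 < c₂ := by positivity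
  let m := min 1 c₁
  let M := max 1 c₂
  have hm : 0 < m := lt_min one_pos hc₁
  have hM : 0 < M := one_pos.trans_le (le_max_left _ _)
  refine ⟨(√m)⁻¹ + R ^ 2 * √M, by positivity, fun r hr => ?_⟩
  have hA0 : 0 ≤ A := sq_nonneg _
  have hRr : 0 < R - r := sub_pos.2 hr.2
  have hr0 : 0 < r := zero_lt_one.trans_le hr.1
  have hE0 := hE r hr
  set X := A + (R - r) with hX
  have hX0 : 0 < X := by positivity
  have hmX : m * X ≤ g r := by
    refine le_trans ?_ (hg1 r hr)
    have i1 : m * A ≤ 1 * A := by gcongr; exact min_le_left _ _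
    have i2 : m * (R - r) ≤ c₁ * (R - r) := by gcongr; exact min_le_right _ _
    rw [hX, mul_add]
    linarith
  have hMX : g r ≤ M * X := by
    refine (hg2 r hr).trans ?_
    have i1 : 1 * A ≤ M * A := by gcongr; exact le_max_left _ _
    have i2 : c₂ * (R - r) ≤ M * (R - r) := by gcongr; exact le_max_right _ _
    rw [hX, mul_add]
    linarith
  have hsqrt : √(g r) = (r ^ 2 * e r)⁻¹ := by
    simp only [g]
    rw [Real.sqrt_inv, Real.sqrt_sq hE0.le]
  have j1 := Real.sqrt_le_sqrt hmX
  have j2 := Real.sqrt_le_sqrt hMX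
  rw [hsqrt, Real.sqrt_mul hm.le] at j1
  rw [hsqrt, Real.sqrt_mul hM.le] at j2
  have hsX : 0 < √X := Real.sqrt_pos.2 hX0
  have hsm : 0 < √m := Real.sqrt_pos.2 hm
  have hsM : 0 < √M := Real.sqrt_pos.2 hM
  have he0 := he r hr
  constructor
  · calc ((√m)⁻¹ + R ^ 2 * √M)⁻¹ / √X ≤ (R ^ 2 * √M)⁻¹ / √X := by
          gcongr
          exact le_add_of_nonneg_left (by positivity)
      _ = (R ^ 2)⁻¹ * (√M * √X)⁻¹ := by rw [mul_inv, mul_inv]; ring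
      _ ≤ (R ^ 2)⁻¹ * (r ^ 2 * e r) := by
          gcongr
          exact inv_le_of_inv_le₀ hE0 j2
      _ ≤ (R ^ 2)⁻¹ * (R ^ 2 * e r) := by
          gcongr
          exact hr.2.le
      _ = e r := by field_simp
  · calc e r = 1 * e r := (one_mul _).symm
      _ ≤ r ^ 2 * e r := by
          gcongr
          exact one_le_pow₀ hr.1
      _ ≤ (√m * √X)⁻¹ := le_inv_of_le_inv₀ (by positivity) j1
      _ = (√m)⁻¹ / √X := by rw [mul_inv, div_eq_mul_inv]
      _ ≤ ((√m)⁻¹ + R ^ 2 * √M) / √X := by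
          gcongr
          exact le_add_of_nonneg_right (by positivity)

end DifferentialInequality

section Derivative

variable {Γ : Type*} [Group Γ] (μ : PMF Γ)

/-- In terms of the return probabilities `aₙ`, this is `(r² η)' = r ∑ (n + 1) (n + 2) aₙ rⁿ`; the
series on the right is twice the sum over triangles, by `two_mul_triple_eq_ofReal`. -/
lemma hasDerivAt_sq_mul_eta {r : ℝ} (h0 : 0 < r) (hr : r < invSpectralRadius μ) :
    HasDerivAt (fun x : ℝ => x ^ 2 * ∑' n : ℕ, x ^ n * ((n + 1) * returnProb μ n))
      (r * ∑' n : ℕ, r ^ n * ((n + 1) * (n + 2) * returnProb μ n)) r := by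
  obtain ⟨s, hrs, hs⟩ := exists_between hr
  have hs0 : 0 < s := h0.trans hrs
  have hu : Summable fun n : ℕ => s * (s ^ n * ((n + 1) * (n + 2) * returnProb μ n)) :=
    (summable_returnProb μ hs0.le hs).mul_left s
  have key := hasDerivAt_tsum_of_isPreconnected (𝕜 := ℝ) (t := Set.Ioo 0 s)
    (g := fun (n : ℕ) (x : ℝ) => x ^ 2 * (x ^ n * ((n + 1) * returnProb μ n)))
    (g' := fun (n : ℕ) (x : ℝ) => x * (x ^ n * ((n + 1) * (n + 2) * returnProb μ n)))
    (y₀ := r) (y := r) hu isOpen_Ioo isPreconnected_Ioo ?_ ?_ ⟨h0, hrs⟩ ?_ ⟨h0, hrs⟩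
  · simpa only [tsum_mul_left] using key
  · intro n x _
    have h := (hasDerivAt_pow (n + 2) x).mul_const ((n + 1) * returnProb μ n)
    have e : (fun x : ℝ => x ^ 2 * (x ^ n * ((n + 1) * returnProb μ n))) =
        fun x : ℝ => x ^ (n + 2) * ((n + 1) * returnProb μ n) := by
      funext x; ring
    rw [e]
    refine h.congr_deriv ?_
    rw [show n + 2 - 1 = n + 1 from rfl]
    push_cast
    ring
  · intro n x hx
    have := returnProb_nonneg μ n
    have hx0 : 0 < x := hx.1
    have hxs : x ≤ s := hx.2.le
    rw [Real.norm_of_nonneg (by positivity)]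
    gcongr
  · exact (summable_eta μ h0.le hr).mul_left _

end Derivative

end RandomWalk

open RandomWalk in
theorem proposition3p2 {Γ : Type*} [Group Γ] (S : Set Γ) (hSfin : S.Finite)
    (hSgen : Subgroup.closure S = ⊤) (hhyp : RandomWalk.IsHyperbolic S)
    (hne : RandomWalk.IsNonElementary S) (μ : PMF Γ) (hadm : RandomWalk.IsAdmissible μ)
    (hanc : RandomWalk.UniformAncona S μ) :
    (∃ C : ℝ, 0 < C ∧ ∀ r ∈ Set.Ico 1 (RandomWalk.invSpectralRadius μ),
      RandomWalk.eta μ r < ∞ ∧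
      ENNReal.ofReal C⁻¹ ≤
        (∑' (x : Γ) (y : Γ),
            RandomWalk.green μ r 1 y * RandomWalk.green μ r y x * RandomWalk.green μ r x 1) /
          (∑' x : Γ, RandomWalk.green μ r 1 x * RandomWalk.green μ r x 1) ^ 3 ∧
      (∑' (x : Γ) (y : Γ),
            RandomWalk.green μ r 1 y * RandomWalk.green μ r y x * RandomWalk.green μ r x 1) /
          (∑' x : Γ, RandomWalk.green μ r 1 x * RandomWalk.green μ r x 1) ^ 3 ≤
        ENNReal.ofReal C) ∧
    (∃ A C : ℝ, 0 ≤ A ∧ 0 < C ∧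
      (∀ r ∈ Set.Ico 1 (RandomWalk.invSpectralRadius μ),
        ENNReal.ofReal (C⁻¹ / √(A + (RandomWalk.invSpectralRadius μ - r))) ≤
            RandomWalk.eta μ r ∧
        RandomWalk.eta μ r ≤
            ENNReal.ofReal (C / √(A + (RandomWalk.invSpectralRadius μ - r)))) ∧
      (A = 0 ↔ RandomWalk.eta μ (RandomWalk.invSpectralRadius μ) = ∞)) := by
  rcases le_or_gt (invSpectralRadius μ) 1 with hR | hR
  · -- The interval `[1, R)` is empty.
    have hempty : ∀ r, r ∉ Set.Ico 1 (invSpectralRadius μ) := fun r hr =>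
      (hr.2.trans_le hR).not_ge hr.1
    refine ⟨⟨1, one_pos, fun r hr => absurd hr (hempty r)⟩, ?_⟩
    by_cases h : eta μ (invSpectralRadius μ) = ∞
    · exact ⟨0, 1, le_rfl, one_pos, fun r hr => absurd hr (hempty r), by simp [h]⟩
    · exact ⟨1, 1, zero_le_one, one_pos, fun r hr => absurd hr (hempty r), by simp [h]⟩
  obtain ⟨k, hd⟩ := isHyperbolicMetric_wordDist hSfin hSgen hhyp
  have hG := mulCayley_connected hSgen
  obtain ⟨γ, hγ⟩ := hd.exists_geodesic_line (hd.unbounded hne.1)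
  have hgrow := hd.superlinear_growth
    (hd.exists_leg (hd.exists_tripod hγ (hd.exists_far_of_line hne.2 hγ)))
  obtain ⟨B, C₀, hturn⟩ := hd.exists_turn hgrow
  have hg := green_spectral_ne_top hadm hd hturn hgrow hR
  obtain ⟨c₁, hc₁, hT₁⟩ := exists_tsum_greenTriangle_le hG hhyp hanc
  obtain ⟨c₂, hc₂, hT₂⟩ := exists_eta_cube_le hadm hd hturn hg
  have hfin : ∀ r ∈ Set.Ico 1 (invSpectralRadius μ), eta μ r ≠ ∞ := fun r hr =>
    eta_ne_top μ (zero_le_one.trans hr.1) hr.2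
  have hpos : ∀ r, eta μ r ≠ 0 := fun r => (zero_lt_one.trans_le (one_le_eta μ r)).ne'
  let K : ℝ := c₁.toReal + c₂.toReal + 1
  have hK : 0 < K := by positivity
  have hK₁ : c₁ ≤ ENNReal.ofReal K := by
    rw [ENNReal.le_ofReal_iff_toReal_le hc₁ hK.le]
    have := ENNReal.toReal_nonneg (a := c₂)
    simp only [K]; linarith
  have hK₂ : c₂ ≤ ENNReal.ofReal K := by
    rw [ENNReal.le_ofReal_iff_toReal_le hc₂ hK.le]
    have := ENNReal.toReal_nonneg (a := c₁)
    simp only [K]; linarith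
  have hTη : ∀ r ∈ Set.Ico 1 (invSpectralRadius μ),
      ∑' (x : Γ) (y : Γ), green μ r 1 y * green μ r y x * green μ r x 1 ≤
        ENNReal.ofReal K * eta μ r ^ 3 := fun r hr =>
    (hT₁ r ⟨hr.1, hr.2.le⟩).trans (mul_le_mul' hK₁ le_rfl)
  have hηT : ∀ r ∈ Set.Ico 1 (invSpectralRadius μ), eta μ r ^ 3 ≤ ENNReal.ofReal K *
      ∑' (x : Γ) (y : Γ), green μ r 1 y * green μ r y x * green μ r x 1 := fun r hr =>
    (hT₂ r ⟨hr.1, hr.2.le⟩).trans (mul_le_mul' hK₂ le_rfl)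
  refine ⟨⟨K, hK, fun r hr => ⟨(hfin r hr).lt_top, ?_, ?_⟩⟩, ?_⟩
  · change _ ≤ _ / eta μ r ^ 3
    rw [ENNReal.le_div_iff_mul_le (Or.inl (pow_ne_zero 3 (hpos r)))
      (Or.inl (ENNReal.pow_ne_top (hfin r hr))), ENNReal.ofReal_inv_of_pos hK]
    exact (mul_le_mul' le_rfl (hηT r hr)).trans_eq (by
      rw [← mul_assoc, ENNReal.inv_mul_cancel (by simpa using hK) ENNReal.ofReal_ne_top, one_mul])
  · change _ / eta μ r ^ 3 ≤ _
    exact ENNReal.div_le_of_le_mul (hTη r hr)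
  · let e : ℝ → ℝ := fun r => ∑' n : ℕ, r ^ n * ((n + 1) * returnProb μ n)
    let s : ℝ → ℝ := fun r => ∑' n : ℕ, r ^ n * ((n + 1) * (n + 2) * returnProb μ n)
    have he : ∀ r ∈ Set.Ico 1 (invSpectralRadius μ), eta μ r = ENNReal.ofReal (e r) :=
      fun r hr => eta_eq_ofReal μ (zero_le_one.trans hr.1) hr.2
    have hs : ∀ r ∈ Set.Ico 1 (invSpectralRadius μ),
        2 * ∑' (x : Γ) (y : Γ), green μ r 1 y * green μ r y x * green μ r x 1 =
          ENNReal.ofReal (s r) :=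
      fun r hr => two_mul_triple_eq_ofReal μ (zero_le_one.trans hr.1) hr.2
    have he0 : ∀ r ∈ Set.Ico 1 (invSpectralRadius μ), 0 < e r := fun r hr => by
      have := hpos r
      rw [he r hr] at this
      simpa using this
    have hs0 : ∀ r ∈ Set.Ico 1 (invSpectralRadius μ), 0 ≤ s r := fun r hr => by
      have hr0 : 0 ≤ r := zero_le_one.trans hr.1
      refine tsum_nonneg fun n => ?_
      have := returnProb_nonneg μ n
      positivity
    have hsle : ∀ r ∈ Set.Ico 1 (invSpectralRadius μ), s r ≤ (2 * K) * e r ^ 3 := fun r hr => by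
      have h := mul_le_mul' (le_refl (2 : ℝ≥0∞)) (hTη r hr)
      rw [hs r hr, he r hr, ← ENNReal.ofReal_pow (he0 r hr).le, ← ENNReal.ofReal_mul hK.le,
        ← ENNReal.ofReal_ofNat 2, ← ENNReal.ofReal_mul zero_le_two] at h
      have h0 := he0 r hr
      rw [ENNReal.ofReal_le_ofReal_iff (by positivity)] at h
      linarith
    have hles : ∀ r ∈ Set.Ico 1 (invSpectralRadius μ), e r ^ 3 ≤ (2 * K) * s r := fun r hr => by
      have h := mul_le_mul' (le_refl (2 : ℝ≥0∞)) (hηT r hr)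
      have h0 := hs0 r hr
      rw [mul_left_comm, hs r hr, he r hr, ← ENNReal.ofReal_pow (he0 r hr).le,
        ← ENNReal.ofReal_mul hK.le, ← ENNReal.ofReal_ofNat 2, ← ENNReal.ofReal_mul zero_le_two,
        ENNReal.ofReal_le_ofReal_iff (by positivity)] at h
      nlinarith [mul_nonneg hK.le h0]
    have hinv : (eta μ (invSpectralRadius μ))⁻¹ ≠ ∞ := ENNReal.inv_ne_top.2 (hpos _)
    have hlim : Filter.Tendsto (fun r => (e r)⁻¹)
        (nhdsWithin (invSpectralRadius μ) (Set.Iio (invSpectralRadius μ)))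
        (nhds ((eta μ (invSpectralRadius μ))⁻¹).toReal) := by
      refine ((ENNReal.tendsto_toReal hinv).comp (tendsto_eta μ _).inv).congr' ?_
      filter_upwards [eventually_mem_Ico hR] with r hr
      simp only [Function.comp_apply]
      rw [he r hr, ENNReal.toReal_inv, ENNReal.toReal_ofReal (he0 r hr).le]
    obtain ⟨C, hC, hbound⟩ := exists_inv_sqrt_bounds hR he0
      (fun r hr => hasDerivAt_sq_mul_eta μ (zero_lt_one.trans_le hr.1) hr.2)
      (mul_pos two_pos hK) hsle hles hlim
    -- The constant `A` is the limit of `(r² η(r))⁻²` as `r` tends to `R`; as `∞⁻¹ = 0`, it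
    -- vanishes exactly if `η(R) = ∞`.
    refine ⟨((invSpectralRadius μ ^ 2)⁻¹ * ((eta μ (invSpectralRadius μ))⁻¹).toReal) ^ 2, C,
      sq_nonneg _, hC, fun r hr => ?_, ?_⟩
    · obtain ⟨hb₁, hb₂⟩ := hbound r hr
      rw [he r hr]
      exact ⟨ENNReal.ofReal_le_ofReal hb₁, ENNReal.ofReal_le_ofReal hb₂⟩
    · have hR0 : invSpectralRadius μ ≠ 0 := (zero_lt_one.trans hR).ne'
      simp [hR0, ENNReal.toReal_eq_zero_iff, hpos]
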